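/- **Setting.** In online facility assignment on a line, servers $s_1<\dots<s_m$ are points of $\mathbb R$ and server $s$ has a capacity $c(s)\in\{1,2,\dots\}$. Requests $\sigma=r_1\cdots r_n$ with $r_i\in\mathbb R$ and $n\le\sum_s c(s)$ arrive one by one. An online algorithm must irrevocably match each request, on arrival, with a free server, i.e. one that has so far received fewer than $c(s)$ requests. Matching $r$ with $s$ costs $|r-s|$. Let $\mathcal A(\sigma)$ be the total cost of the algorithm $\mathcal A$ and $\mathrm{Opt}(\sigma)$ the minimum cost of a matching of $\sigma$ that respects the capacities. $\mathcal A$ is $\rho$-competitive if $\mathcal A(\sigma)\le\rho\,\mathrm{Opt}(\sigma)$ for all such $\sigma$, and its competitive ratio is $\mathcal R(\mathcal A)=\inf\{\rho\ge 1:\mathcal A\text{ is }\rho\text{-competitive}\}$. **PTCP.** For a server set $S=\{s_1<\dots<s_m\}$ with $m\ge 2$, let $s_{a+1}-s_a=D$ be a maximum gap between adjacent servers, $S_1=\{s_1,\dots,s_a\}$, $S_2=\{s_{a+1},\dots,s_m\}$, $\Delta_1=s_a-s_1$, $\Delta_2=s_m-s_{a+1}$ and $x=\frac{\Delta_2+D}{(\Delta_1+D)+(\Delta_2+D)}D$.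 When $F\ne\emptyset$ is the set of free servers, PTCP matches a request $r$ with the server $\mathcal A^*[S](r,F)$, defined recursively: it is $s$ if $F=\{s\}$; otherwise it is $\mathcal A^*[S_1](r,F\cap S_1)$ if ($r\le s_a+x$ and $F\cap S_1\neq\emptyset$) or $F\cap S_2=\emptyset$; and it is $\mathcal A^*[S_2](r,F\cap S_2)$ in all other cases. **Permutation.** For every request sequence $\sigma$ as above fix an optimal matching $M_\sigma$ such that, whenever $\sigma$ is extended by one request $r$, the multiset of servers used by $M_{\sigma r}$ is that used by $M_\sigma$ plus one further server $s$ (such a choice is always possible). The Permutation algorithm, after having processed $\sigma$, matches $r$ with this $s$. If several choices of the $M_\sigma$ are possible, the theorem holds for each of them. **Theorem.** Let $k\ge1$ and $\varepsilon>0$. There exist $\delta\in(0,1)$ with $$\delta^k+\delta(4k-1)<\varepsilon\qquad\text{and}\qquad (1-\delta)^{-1}<1+\varepsilon/2 .$$ For every such $\delta$, let $S=\{s_1,\dots,s_{2k}\}$ be given by $$s_{k+i}=\frac{1-\delta^i}{1-\delta},\qquad s_{k-i+1}=-\frac{1-\delta^i}{1-\delta}\qquad(i=1,\dots,k).$$ Then,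 for every capacity $c:S\to\{1,2,\dots\}$, PTCP is $(3+\varepsilon)$-competitive, and the competitive ratio of the Permutation algorithm is at least $4k-1-\varepsilon$. -/

import Mathlib

open Finset

namespace OFAL

/-! Online facility assignment on the real line.  The servers are indexed by `Fin m`, server `s`
stands at the point `p s` and can serve at most `c s` requests.  A request is a point of the line,
a request sequence is a list (in order of arrival), and a matching is the list of the pairs
(request, server that serves it). -/

/-- A (partial) matching: the pairs (request, server), in the order of arrival. -/
abbrev Matching (m : ℕ) : Type := List (ℝ × Fin m)

/-- The number of requests that the matching `M` assigns to the server `s`. -/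
def load {m : ℕ} (M : Matching m) (s : Fin m) : ℕ := M.countP (fun e => decide (e.2 = s))

/-- The cost of a matching: the sum of the distances between requests and their servers. -/
noncomputable def cost {m : ℕ} (p : Fin m → ℝ) (M : Matching m) : ℝ :=
  (M.map (fun e => |e.1 - p e.2|)).sum

/-- The servers that are free (not full) in the matching `M`. -/
def free {m : ℕ} (c : Fin m → ℕ) (M : Matching m) : Finset (Fin m) :=
  univ.filter (fun s => load M s < c s)

/-- A request sequence is admissible if it is not longer than the total capacity. -/
def Admissible {m : ℕ} (c : Fin m → ℕ) (σ : List ℝ) : Prop := σ.length ≤ ∑ s, c s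

/-- `M` matches exactly the requests of `σ` and respects the capacities. -/
def IsMatching {m : ℕ} (c : Fin m → ℕ) (σ : List ℝ) (M : Matching m) : Prop :=
  M.map Prod.fst = σ ∧ ∀ s, load M s ≤ c s

/-- `M` is an optimal (minimum cost) matching of the requests of `σ`. -/
def IsOptimalMatching {m : ℕ} (p : Fin m → ℝ) (c : Fin m → ℕ) (σ : List ℝ) (M : Matching m) :
    Prop :=
  IsMatching c σ M ∧ ∀ M', IsMatching c σ M' → cost p M ≤ cost p M'

/-- The optimal offline cost of `σ`.  For an admissible `σ` this is the infimum of a finite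
non-empty set, that is, a minimum. -/
noncomputable def optCost {m : ℕ} (p : Fin m → ℝ) (c : Fin m → ℕ) (σ : List ℝ) : ℝ :=
  sInf (cost p '' {M | IsMatching c σ M})

/-- A deterministic online algorithm: given the current matching (which records all past requests
and how they were served) and the new request, it picks a free server, as long as there is one. -/
structure OnlineAlgorithm {m : ℕ} (c : Fin m → ℕ) where
  /-- The server chosen for the new request. -/
  pick : (M : Matching m) → ℝ → (free c M).Nonempty → Fin m
  /-- The chosen server is free. -/
  pick_mem : ∀ M r h, pick M r h ∈ free c M

/-- The matching after one more request.  (Without any free server nothing is done; this never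
happens on admissible sequences.) -/
def OnlineAlgorithm.step {m : ℕ} {c : Fin m → ℕ} (A : OnlineAlgorithm c) (M : Matching m) (r : ℝ) :
    Matching m :=
  if h : (free c M).Nonempty then M ++ [(r, A.pick M r h)] else M

/-- The matching that the online algorithm produces on the request sequence `σ`. -/
def OnlineAlgorithm.run {m : ℕ} {c : Fin m → ℕ} (A : OnlineAlgorithm c) (σ : List ℝ) : Matching m :=
  σ.foldl A.step []

/-- `A` is `ρ`-competitive (in the strict sense). -/
def IsCompetitive {m : ℕ} (p : Fin m → ℝ) {c : Fin m → ℕ} (A : OnlineAlgorithm c) (ρ : ℝ) : Prop :=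
  ∀ σ : List ℝ, Admissible c σ → cost p (A.run σ) ≤ ρ * optCost p c σ

/-- The competitive ratio of `A`: the infimum of the `ρ ≥ 1` such that `A` is `ρ`-competitive
(`⊤` if there is none). -/
noncomputable def competitiveRatio {m : ℕ} (p : Fin m → ℝ) {c : Fin m → ℕ} (A : OnlineAlgorithm c) :
    EReal :=
  sInf ((fun ρ : ℝ => (ρ : EReal)) '' {ρ : ℝ | 1 ≤ ρ ∧ IsCompetitive p A ρ})

/-! ### The algorithm PTCP -/

/-- The pairs of adjacent servers of the set `S`. -/
def adjacentPairs {m : ℕ} (S : Finset (Fin m)) : Finset (Fin m × Fin m) :=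
  (S ×ˢ S).filter (fun q => q.1 < q.2 ∧ ∀ t ∈ S, t ≤ q.1 ∨ q.2 ≤ t)

theorem adjacentPairs_nonempty {m : ℕ} {S : Finset (Fin m)} (h : 2 ≤ S.card) :
    (adjacentPairs S).Nonempty := by
  obtain ⟨a, ha, b, hb, hab⟩ := Finset.one_lt_card.1 h
  have hne : S.Nonempty := ⟨a, ha⟩
  have hT : (S.filter (fun t => S.min' hne < t)).Nonempty := by
    by_contra hcon
    rw [Finset.not_nonempty_iff_eq_empty, Finset.filter_eq_empty_iff] at hcon
    have h1 := le_antisymm (not_lt.1 (hcon ha)) (S.min'_le a ha)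
    have h2 := le_antisymm (not_lt.1 (hcon hb)) (S.min'_le b hb)
    exact hab (h1.trans h2.symm)
  have hm := Finset.mem_filter.1 (Finset.min'_mem _ hT)
  refine ⟨(S.min' hne, (S.filter (fun t => S.min' hne < t)).min' hT), ?_⟩
  simp only [adjacentPairs, Finset.mem_filter, Finset.mem_product]
  refine ⟨⟨S.min'_mem hne, hm.1⟩, hm.2, fun t ht => ?_⟩
  rcases lt_or_ge (S.min' hne) t with h | h
  · exact Or.inr (Finset.min'_le _ _ (Finset.mem_filter.2 ⟨ht, h⟩))
  · exact Or.inl h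

/-- A pair of adjacent servers of `S` at maximum distance (the choice among ties is arbitrary). -/
noncomputable def splitPair {m : ℕ} (p : Fin m → ℝ) (S : Finset (Fin m)) (h : 2 ≤ S.card) :
    Fin m × Fin m :=
  (Finset.exists_max_image (adjacentPairs S) (fun q => p q.2 - p q.1)
    (adjacentPairs_nonempty h)).choose

theorem splitPair_spec {m : ℕ} (p : Fin m → ℝ) (S : Finset (Fin m)) (h : 2 ≤ S.card) :
    splitPair p S h ∈ adjacentPairs S ∧ ∀ q ∈ adjacentPairs S,
      p q.2 - p q.1 ≤ p (splitPair p S h).2 - p (splitPair p S h).1 :=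
  (Finset.exists_max_image (adjacentPairs S) (fun q => p q.2 - p q.1)
    (adjacentPairs_nonempty h)).choose_spec

/-- The servers of `S` to the left of the maximum gap. -/
noncomputable def leftPart {m : ℕ} (p : Fin m → ℝ) (S : Finset (Fin m)) (h : 2 ≤ S.card) :
    Finset (Fin m) :=
  S.filter (fun t => t ≤ (splitPair p S h).1)

/-- The servers of `S` to the right of the maximum gap. -/
noncomputable def rightPart {m : ℕ} (p : Fin m → ℝ) (S : Finset (Fin m)) (h : 2 ≤ S.card) :
    Finset (Fin m) :=
  S.filter (fun t => (splitPair p S h).2 ≤ t)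

/-- The critical point `s_a + x` with `x = (Δ₂ + D) / ((Δ₁ + D) + (Δ₂ + D)) * D`, where `D` is the
maximum gap `s_{a+1} - s_a`, and `Δ₁`, `Δ₂` are the diameters of the left and the right part. -/
noncomputable def criticalPoint {m : ℕ} (p : Fin m → ℝ) (S : Finset (Fin m)) (h : 2 ≤ S.card) : ℝ :=
  let hne : S.Nonempty := Finset.card_pos.1 (lt_of_lt_of_le Nat.zero_lt_two h)
  let a := (splitPair p S h).1
  let b := (splitPair p S h).2
  let D := p b - p a
  let Δ₁ := p a - p (S.min' hne)
  let Δ₂ := p (S.max' hne) - p b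
  p a + (Δ₂ + D) / ((Δ₁ + D) + (Δ₂ + D)) * D

theorem leftPart_card_lt {m : ℕ} (p : Fin m → ℝ) (S : Finset (Fin m)) (h : 2 ≤ S.card) :
    (leftPart p S h).card < S.card := by
  have hs := (splitPair_spec p S h).1
  simp only [adjacentPairs, Finset.mem_filter, Finset.mem_product] at hs
  refine Finset.card_lt_card ((Finset.ssubset_iff_of_subset (Finset.filter_subset _ _)).2
    ⟨_, hs.1.2, fun hm => ?_⟩)
  exact absurd (Finset.mem_filter.1 hm).2 (not_le.2 hs.2.1)

theorem rightPart_card_lt {m : ℕ} (p : Fin m → ℝ) (S : Finset (Fin m)) (h : 2 ≤ S.card) :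
    (rightPart p S h).card < S.card := by
  have hs := (splitPair_spec p S h).1
  simp only [adjacentPairs, Finset.mem_filter, Finset.mem_product] at hs
  refine Finset.card_lt_card ((Finset.ssubset_iff_of_subset (Finset.filter_subset _ _)).2
    ⟨_, hs.1.1, fun hm => ?_⟩)
  exact absurd (Finset.mem_filter.1 hm).2 (not_le.2 hs.2.1)

theorem left_or_right {m : ℕ} (p : Fin m → ℝ) (S : Finset (Fin m)) (h : 2 ≤ S.card) {t : Fin m}
    (ht : t ∈ S) : t ∈ leftPart p S h ∨ t ∈ rightPart p S h := by
  have hs := (splitPair_spec p S h).1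
  simp only [adjacentPairs, Finset.mem_filter, Finset.mem_product] at hs
  rcases hs.2.2 t ht with h1 | h1
  · exact Or.inl (Finset.mem_filter.2 ⟨ht, h1⟩)
  · exact Or.inr (Finset.mem_filter.2 ⟨ht, h1⟩)

open Classical in
/-- The server with which PTCP for the server set `S` matches a request at `r`, when `F` is the
(non-empty) set of free servers of `S`. -/
noncomputable def ptcpServer {m : ℕ} (p : Fin m → ℝ) (r : ℝ) (S F : Finset (Fin m)) (hFS : F ⊆ S)
    (hF : F.Nonempty) : {s : Fin m // s ∈ F} :=
  if h1 : F.card = 1 then ⟨hF.choose, hF.choose_spec⟩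
  else
    have h2 : 2 ≤ S.card := by
      have h3 := Finset.card_le_card hFS
      have h4 := Finset.card_pos.2 hF
      omega
    if hL : (r ≤ criticalPoint p S h2 ∧ (F ∩ leftPart p S h2).Nonempty) ∨
        F ∩ rightPart p S h2 = ∅ then
      have hne : (F ∩ leftPart p S h2).Nonempty := by
        rcases hL with hL | hL
        · exact hL.2
        · obtain ⟨t, ht⟩ := hF
          rcases left_or_right p S h2 (hFS ht) with h5 | h5
          · exact ⟨t, Finset.mem_inter.2 ⟨ht, h5⟩⟩
          · exact absurd (Finset.mem_inter.2 ⟨ht, h5⟩) (by rw [hL]; exact Finset.notMem_empty t)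
      let s := ptcpServer p r (leftPart p S h2) (F ∩ leftPart p S h2) Finset.inter_subset_right hne
      ⟨s.1, (Finset.mem_inter.1 s.2).1⟩
    else
      have hne : (F ∩ rightPart p S h2).Nonempty :=
        Finset.nonempty_iff_ne_empty.2 (fun h6 => hL (Or.inr h6))
      let s := ptcpServer p r (rightPart p S h2) (F ∩ rightPart p S h2) Finset.inter_subset_right hne
      ⟨s.1, (Finset.mem_inter.1 s.2).1⟩
termination_by S.card
decreasing_by
  · exact leftPart_card_lt p S h2
  · exact rightPart_card_lt p S h2

/-- The online algorithm PTCP (Policy Transition at Critical Point). -/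
noncomputable def ptcp {m : ℕ} (p : Fin m → ℝ) (c : Fin m → ℕ) : OnlineAlgorithm c where
  pick M r h := (ptcpServer p r univ (free c M) (Finset.subset_univ _) h).1
  pick_mem M r h := (ptcpServer p r univ (free c M) (Finset.subset_univ _) h).2

/-! ### The Permutation algorithm -/

/-- `A` is the Permutation algorithm (with some way of choosing among several optimal matchings):
there are optimal matchings `Opt σ` of all admissible sequences `σ` such that, when a request `r`
arrives after `σ`, the servers used by `Opt (σ r)`, counted with multiplicity, are those used by
`Opt σ` together with one further server `s`, and `A` matches `r` with this server `s`. -/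
def IsPermutationAlgorithm {m : ℕ} (p : Fin m → ℝ) {c : Fin m → ℕ} (A : OnlineAlgorithm c) : Prop :=
  ∃ Opt : List ℝ → Matching m,
    (∀ σ, Admissible c σ → IsOptimalMatching p c σ (Opt σ)) ∧
    ∀ (σ : List ℝ) (r : ℝ), Admissible c (σ ++ [r]) →
      ∃ s : Fin m, (∀ t, load (Opt (σ ++ [r])) t = load (Opt σ) t + if t = s then 1 else 0) ∧
        A.run (σ ++ [r]) = A.run σ ++ [(r, s)]

/-! ### Permutation algorithms exist -/

theorem load_append {m : ℕ} (M N : Matching m) (s : Fin m) :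
    load (M ++ N) s = load M s + load N s := by
  simp [load]

theorem load_cons {m : ℕ} (e : ℝ × Fin m) (M : Matching m) (s : Fin m) :
    load (e :: M) s = load M s + if s = e.2 then 1 else 0 := by
  simp [load, List.countP_cons, eq_comm]

theorem load_nil {m : ℕ} (s : Fin m) : load ([] : Matching m) s = 0 := rfl

theorem sum_load {m : ℕ} (M : Matching m) : ∑ s, load M s = M.length := by
  induction M with
  | nil => simp [load_nil]
  | cons e M ih => simp [load_cons, Finset.sum_add_distrib, ih]

theorem cost_append {m : ℕ} (p : Fin m → ℝ) (M N : Matching m) :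
    cost p (M ++ N) = cost p M + cost p N := by
  simp [cost]

theorem cost_cons {m : ℕ} (p : Fin m → ℝ) (e : ℝ × Fin m) (M : Matching m) :
    cost p (e :: M) = |e.1 - p e.2| + cost p M := by
  simp [cost]

/-- Two matchings of the same requests, exchanged along an alternating path that starts at `s`. -/
theorem exists_exchange {m : ℕ} (p : Fin m → ℝ) (n : ℕ) : ∀ (L : List (ℝ × Fin m × Fin m)),
    L.length = n → ∀ s,
    load (L.map (fun e => (e.1, e.2.2))) s < load (L.map (fun e => (e.1, e.2.1))) s →
    ∃ (L' : List (ℝ × Fin m × Fin m)) (t : Fin m), L'.map Prod.fst = L.map Prod.fst ∧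
      cost p (L'.map (fun e => (e.1, e.2.1))) + cost p (L'.map (fun e => (e.1, e.2.2))) =
        cost p (L.map (fun e => (e.1, e.2.1))) + cost p (L.map (fun e => (e.1, e.2.2))) ∧
      load (L.map (fun e => (e.1, e.2.1))) t < load (L.map (fun e => (e.1, e.2.2))) t ∧
      (∀ u, load (L'.map (fun e => (e.1, e.2.1))) u + (if u = s then 1 else 0) =
        load (L.map (fun e => (e.1, e.2.1))) u + if u = t then 1 else 0) ∧
      (∀ u, load (L'.map (fun e => (e.1, e.2.2))) u + (if u = t then 1 else 0) =
        load (L.map (fun e => (e.1, e.2.2))) u + if u = s then 1 else 0) := by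
  induction n with
  | zero =>
    intro L hL s h
    rw [List.length_eq_zero_iff] at hL
    subst hL
    simp [load_nil] at h
  | succ n ih =>
    intro L hL s h
    have hex : ∃ e ∈ L, e.2.1 = s ∧ e.2.2 ≠ s := by
      by_contra! hcon
      apply absurd h
      rw [not_lt]
      simp only [load, List.countP_map]
      refine List.countP_mono_left fun e he h1 => ?_
      simp only [Function.comp_apply, decide_eq_true_eq] at h1 ⊢
      exact hcon e he h1
    obtain ⟨⟨r, a, b⟩, he, ha, hb⟩ := hex
    simp only at ha hb
    subst ha
    obtain ⟨L₁, L₂, rfl⟩ := List.append_of_mem he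
    by_cases hs : load ((L₁ ++ (r, a, b) :: L₂).map (fun e => (e.1, e.2.1))) b <
        load ((L₁ ++ (r, a, b) :: L₂).map (fun e => (e.1, e.2.2))) b
    · refine ⟨L₁ ++ (r, b, a) :: L₂, b, by simp, ?_, hs, ?_, ?_⟩
      · simp only [List.map_append, List.map_cons, cost_append, cost_cons]; ring
      · intro u
        simp only [List.map_append, List.map_cons, load_append, load_cons]; ring
      · intro u
        simp only [List.map_append, List.map_cons, load_append, load_cons]; ring
    · have hlen : (L₁ ++ L₂).length = n := by simp at hL ⊢; omega
      simp only [List.map_append, List.map_cons, load_append, load_cons] at hs h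
      obtain ⟨L', t, h1, h2, h3, h4, h5⟩ := ih (L₁ ++ L₂) hlen b (by
        simp only [List.map_append, load_append]
        simp [hb] at hs
        omega)
      rw [List.map_append, List.map_eq_append_iff] at h1
      obtain ⟨L₁', L₂', rfl, h6, h7⟩ := h1
      simp only [List.map_append, load_append, cost_append] at h2 h3 h4 h5
      refine ⟨L₁' ++ (r, b, a) :: L₂', t, by simp [h6, h7], ?_, ?_, ?_, ?_⟩
      · simp only [List.map_append, List.map_cons, cost_append, cost_cons]; linarith
      · simp only [List.map_append, List.map_cons, load_append, load_cons]
        by_cases hta : t = a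
        · subst hta
          simp [Ne.symm hb] at h
          omega
        · simp only [hta, if_false]; omega
      · intro u
        have := h4 u
        simp only [List.map_append, List.map_cons, load_append, load_cons]; omega
      · intro u
        have := h5 u
        simp only [List.map_append, List.map_cons, load_append, load_cons]; omega

theorem exists_zip {m : ℕ} (M : Matching m) : ∀ N : Matching m, M.map Prod.fst = N.map Prod.fst →
    ∃ L : List (ℝ × Fin m × Fin m), L.map Prod.fst = M.map Prod.fst ∧
      L.map (fun e => (e.1, e.2.1)) = M ∧ L.map (fun e => (e.1, e.2.2)) = N := by
  induction M with
  | nil =>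
    intro N h
    have h0 : N = [] := by simpa using h.symm
    exact ⟨[], by simp [h0]⟩
  | cons e M ih =>
    intro N h
    cases N with
    | nil => simp at h
    | cons e' N =>
      simp only [List.map_cons, List.cons.injEq] at h
      obtain ⟨L, h1, h2, h3⟩ := ih N h.2
      refine ⟨(e.1, e.2, e'.2) :: L, by simp [h1], by simp [h2], ?_⟩
      simp [h3, h.1]

theorem exists_isOptimalMatching {m : ℕ} (p : Fin m → ℝ) (c : Fin m → ℕ) (σ : List ℝ)
    (h : ∃ M, IsMatching c σ M) : ∃ M, IsOptimalMatching p c σ M := by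
  have hfin : {M : Matching m | IsMatching c σ M}.Finite := by
    refine ((List.finite_length_eq (Fin m) σ.length).image (fun l => σ.zip l)).subset ?_
    rintro M ⟨h1, -⟩
    refine ⟨M.map Prod.snd, by simp [← h1], ?_⟩
    subst h1
    exact (List.zip_of_prod rfl rfl).symm
  obtain ⟨M, hM, hmin⟩ := Set.exists_min_image _ (cost p) hfin h
  exact ⟨M, hM, hmin⟩

theorem exists_extension {m : ℕ} (p : Fin m → ℝ) (c : Fin m → ℕ) (σ : List ℝ) (r : ℝ)
    (hσ : Admissible c (σ ++ [r])) (M : Matching m) (hM : IsOptimalMatching p c σ M) :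
    ∃ (M' : Matching m) (s : Fin m), IsOptimalMatching p c (σ ++ [r]) M' ∧
      ∀ t, load M' t = load M t + if t = s then 1 else 0 := by
  have key : ∀ (d : ℕ) (G : Matching m), IsOptimalMatching p c (σ ++ [r]) G →
      ∑ s, (load M s - load G s) = d → ∃ M', IsOptimalMatching p c (σ ++ [r]) M' ∧
        ∀ t, load M t ≤ load M' t := by
    intro d
    induction d using Nat.strong_induction_on with
    | _ d ih =>
    intro G hG hd
    by_cases hall : ∀ t, load M t ≤ load G t
    · exact ⟨G, hG, hall⟩
    push Not at hall
    obtain ⟨s, hs⟩ := hall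
    have hG1 := hG.1.1
    rw [List.map_eq_append_iff] at hG1
    obtain ⟨G₀, G₁, rfl, hG0, hG1⟩ := hG1
    obtain ⟨L, hL0, hL1, hL2⟩ := exists_zip M G₀ (hM.1.1.trans hG0.symm)
    have hcost := hM.2
    simp only [load_append] at hs
    obtain ⟨L', t, h1, h2, h3, h4, h5⟩ := exists_exchange p L.length L rfl s (by
      rw [hL1, hL2]; omega)
    rw [hL1, hL2] at h2 h3
    rw [hL1] at h4
    rw [hL2] at h5
    have hst : t ≠ s := by rintro rfl; omega
    have hM1 : IsMatching c σ (L'.map (fun e => (e.1, e.2.1))) := by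
      refine ⟨?_, fun u => ?_⟩
      · rw [← hM.1.1, ← hL0, ← h1]; simp
      · have ha := h4 u
        have hb := hM.1.2 u
        have hc := hG.1.2 t
        rw [load_append] at hc
        by_cases hu : u = t
        · subst hu; simp [hst] at ha; omega
        · simp [hu] at ha; omega
    have hN1 : IsMatching c (σ ++ [r]) (L'.map (fun e => (e.1, e.2.2)) ++ G₁) := by
      refine ⟨?_, fun u => ?_⟩
      · rw [List.map_append, hG1, ← hM.1.1, ← hL0, ← h1]; simp
      · have ha := h5 u
        have hb := hG.1.2 u
        have hc := hM.1.2 s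
        rw [load_append] at hb ⊢
        by_cases hu : u = s
        · subst hu; simp [Ne.symm hst] at ha; omega
        · simp [hu] at ha; omega
    have hc1 := hM.2 _ hM1
    have hopt : IsOptimalMatching p c (σ ++ [r]) (L'.map (fun e => (e.1, e.2.2)) ++ G₁) := by
      refine ⟨hN1, fun N hN => le_trans ?_ (hG.2 N hN)⟩
      rw [cost_append, cost_append]; linarith
    refine ih _ ?_ _ hopt rfl
    rw [← hd]
    refine Finset.sum_lt_sum (fun u _ => ?_) ⟨s, Finset.mem_univ _, ?_⟩
    · have ha := h5 u
      rw [load_append, load_append]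
      by_cases hu : u = t
      · subst hu; simp [hst] at ha; omega
      · simp [hu] at ha; omega
    · have ha := h5 s
      rw [load_append, load_append]
      simp [Ne.symm hst] at ha; omega
  have hlen : M.length = σ.length := by rw [← hM.1.1]; simp
  have hfeas : ∃ N, IsMatching c (σ ++ [r]) N := by
    have hlt : ∑ s, load M s < ∑ s, c s := by
      have := hσ
      simp only [Admissible, List.length_append, List.length_singleton] at this
      rw [sum_load]; omega
    obtain ⟨s, -, hs⟩ := Finset.exists_lt_of_sum_lt hlt
    refine ⟨M ++ [(r, s)], by simp [hM.1.1], fun t => ?_⟩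
    have := hM.1.2 t
    rw [load_append, load_cons, load_nil]
    by_cases ht : t = s
    · subst ht; simp; omega
    · simp [ht]; omega
  obtain ⟨G, hG⟩ := exists_isOptimalMatching p c _ hfeas
  obtain ⟨M', hM', hle⟩ := key _ G hG rfl
  have hlen' : M'.length = σ.length + 1 := by
    have := congrArg List.length hM'.1.1
    simpa using this
  have hlt : ∑ s, load M s < ∑ s, load M' s := by rw [sum_load, sum_load]; omega
  obtain ⟨s, -, hs⟩ := Finset.exists_lt_of_sum_lt hlt
  refine ⟨M', s, hM', fun t => ?_⟩
  have hle' : ∀ u ∈ univ, load M u + (if u = s then 1 else 0) ≤ load M' u := by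
    intro u _
    by_cases hu : u = s
    · subst hu; simp; omega
    · simpa [hu] using hle u
  have hsum : ∑ u, (load M u + if u = s then 1 else 0) = ∑ u, load M' u := by
    rw [Finset.sum_add_distrib, sum_load, sum_load]; simp; omega
  exact ((Finset.sum_eq_sum_iff_of_le hle').1 hsum t (Finset.mem_univ t)).symm

/-- Permutation algorithms exist for all positions and capacities of the servers. -/
theorem exists_isPermutationAlgorithm {m : ℕ} (p : Fin m → ℝ) (c : Fin m → ℕ) :
    ∃ A : OnlineAlgorithm c, IsPermutationAlgorithm p A := by
  classical
  let next : List ℝ × Matching m → ℝ → Matching m := fun q r =>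
    if h : ∃ (M' : Matching m) (s : Fin m), IsOptimalMatching p c (q.1 ++ [r]) M' ∧
      ∀ t, load M' t = load q.2 t + if t = s then 1 else 0 then h.choose else []
  let st : List ℝ → List ℝ × Matching m := fun σ =>
    σ.foldl (fun q r => (q.1 ++ [r], next q r)) ([], [])
  have st_snoc : ∀ σ r, st (σ ++ [r]) = ((st σ).1 ++ [r], next (st σ) r) := by
    intro σ r; simp [st]
  have st_fst : ∀ σ, (st σ).1 = σ := by
    intro σ
    induction σ using List.reverseRecOn with
    | nil => rfl
    | append_singleton σ r ih => rw [st_snoc, ih]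
  have adm : ∀ σ r, Admissible c (σ ++ [r]) → Admissible c σ := by
    intro σ r h
    simp only [Admissible, List.length_append, List.length_singleton] at h ⊢
    omega
  have hnext : ∀ σ r, Admissible c (σ ++ [r]) → IsOptimalMatching p c σ (st σ).2 →
      IsOptimalMatching p c (σ ++ [r]) (st (σ ++ [r])).2 ∧ ∃ s, ∀ t,
        load (st (σ ++ [r])).2 t = load (st σ).2 t + if t = s then 1 else 0 := by
    intro σ r h hopt
    have hex := exists_extension p c σ r h _ hopt
    rw [st_snoc]
    simp only [next, st_fst]
    rw [dif_pos hex]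
    obtain ⟨s, h1, h2⟩ := hex.choose_spec
    exact ⟨h1, s, h2⟩
  have hopt : ∀ σ, Admissible c σ → IsOptimalMatching p c σ (st σ).2 := by
    intro σ
    induction σ using List.reverseRecOn with
    | nil =>
      intro _
      refine ⟨⟨rfl, fun s => Nat.zero_le _⟩, fun M' hM' => ?_⟩
      have h0 : M' = [] := by simpa using hM'.1
      rw [h0]
      exact le_rfl
    | append_singleton σ r ih => exact fun h => (hnext σ r h (ih (adm σ r h))).1
  let good : Matching m → ℝ → Fin m → Prop := fun N r s => s ∈ free c N ∧
    ∀ t, load (st (N.map Prod.fst ++ [r])).2 t =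
      load (st (N.map Prod.fst)).2 t + if t = s then 1 else 0
  let A : OnlineAlgorithm c :=
    { pick := fun N r h => if hg : ∃ s, good N r s then hg.choose else h.choose
      pick_mem := by
        intro N r h
        split_ifs with hg
        · exact hg.choose_spec.1
        · exact h.choose_spec }
  have run_snoc : ∀ σ r, A.run (σ ++ [r]) = A.step (A.run σ) r := by
    intro σ r; simp [OnlineAlgorithm.run]
  have hstep : ∀ σ r, Admissible c (σ ++ [r]) → (A.run σ).map Prod.fst = σ →
      (∀ t, load (A.run σ) t = load (st σ).2 t) → ∃ s, (∀ t,
        load (st (σ ++ [r])).2 t = load (st σ).2 t + if t = s then 1 else 0) ∧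
        A.run (σ ++ [r]) = A.run σ ++ [(r, s)] := by
    intro σ r h hfst hload
    obtain ⟨hM', s, hs⟩ := hnext σ r h (hopt σ (adm σ r h))
    have hfree : s ∈ free c (A.run σ) := by
      have h1 := hM'.1.2 s
      rw [hs s, if_pos rfl] at h1
      simp only [free, Finset.mem_filter, Finset.mem_univ, true_and, hload s]
      omega
    have hg : ∃ s, good (A.run σ) r s := ⟨s, hfree, by rw [hfst]; exact hs⟩
    refine ⟨hg.choose, ?_, ?_⟩
    · have := hg.choose_spec.2
      rwa [hfst] at this
    · rw [run_snoc, OnlineAlgorithm.step, dif_pos ⟨s, hfree⟩]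
      simp only [A]
      rw [dif_pos hg]
  have hrun : ∀ σ, Admissible c σ → (A.run σ).map Prod.fst = σ ∧
      ∀ t, load (A.run σ) t = load (st σ).2 t := by
    intro σ
    induction σ using List.reverseRecOn with
    | nil => exact fun _ => ⟨rfl, fun t => rfl⟩
    | append_singleton σ r ih =>
      intro h
      obtain ⟨h1, h2⟩ := ih (adm σ r h)
      obtain ⟨s, h3, h4⟩ := hstep σ r h h1 h2
      refine ⟨by rw [h4]; simp [h1], fun t => ?_⟩
      rw [h4, h3, load_append, load_cons, load_nil, h2]
      simp
  refine ⟨A, fun σ => (st σ).2, hopt, fun σ r h => ?_⟩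
  obtain ⟨h1, h2⟩ := hrun σ (adm σ r h)
  exact hstep σ r h h1 h2

/-! ### The server layout -/

/-- The layout of `2k` servers: the servers `s_{k+i}` and `s_{k-i+1}`, for `i = 1, …, k`, stand at
`(1 - δ ^ i) / (1 - δ)` and at `-(1 - δ ^ i) / (1 - δ)`.  The server `s_j` has index `j - 1`. -/
noncomputable def layout (k : ℕ) (δ : ℝ) (j : Fin (2 * k)) : ℝ :=
  if (j : ℕ) < k then -((1 - δ ^ (k - (j : ℕ))) / (1 - δ))
  else (1 - δ ^ ((j : ℕ) + 1 - k)) / (1 - δ)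

end OFAL

/-!
Serving a request by its server in an optimal matching instead of by the server that the algorithm
prefers exchanges one free place for another.  It therefore suffices to bound the extra cost of a
run of PTCP that has a place at `a` instead of at `b`.  The bound is a potential: the distance of
`a` and `b` plus a detour term, which pays for the side of the layout on which the free servers
have run out.  On the layout, PTCP prefers one server to another according to a separating point
that depends only on the two servers, and the sizes of the gaps make the potential work with the
ratio `1 + 2 / (1 - δ)`.

The lower bound for Permutation comes from a chase: when a single place is left everywhere, each
new request arrives at the server used last.  The optimal matching can shift its servers along
each side, hence it always just adds the server next closest to the start of the chase, and the
algorithm zigzags between the two sides, paying at least `2` for each of these requests.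
-/

namespace OFAL

open scoped Pointwise

/-- `g` lies farther from the origin than `b`, on the same side: `0 < b < g` or `g < b < 0`. -/
def Beyond (b g : ℝ) : Prop := b * b < b * g

/-- The preference between two servers `s` and `g` that PTCP gives to a request at a server `x`.
For `0 < s` a server farther out loses to `s` if `x ≤ s`, and any other one loses to `s` if `x`
lies to the right both of the origin and of that server. -/
def PrefersFrom (x s g : ℝ) : Prop :=
  (Beyond s g → ¬ Beyond s x) ∧ (¬ Beyond s g → 0 < s * x ∧ s * g < s * x)

section Line

variable {x s g a b r X K : ℝ} {G G' : Set ℝ}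

theorem beyond_neg_neg : Beyond (-b) (-g) ↔ Beyond b g := by
  simp only [Beyond, neg_mul_neg]

theorem beyond_iff_of_pos (hb : 0 < b) : Beyond b g ↔ b < g :=
  mul_lt_mul_iff_right₀ hb

theorem beyond_iff_of_neg (hb : b < 0) : Beyond b g ↔ g < b :=
  mul_lt_mul_left_of_neg hb

theorem prefersFrom_neg : PrefersFrom (-x) (-s) (-g) ↔ PrefersFrom x s g := by
  simp only [PrefersFrom, beyond_neg_neg, neg_mul_neg]

theorem prefersFrom_iff_of_pos (hs : 0 < s) :
    PrefersFrom x s g ↔ (s < g → x ≤ s) ∧ (g ≤ s → 0 < x ∧ g < x) := by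
  simp only [PrefersFrom, beyond_iff_of_pos hs, not_lt, mul_pos_iff_of_pos_left hs,
    mul_lt_mul_iff_right₀ hs]

theorem prefersFrom_iff_of_neg (hs : s < 0) :
    PrefersFrom x s g ↔ (g < s → s ≤ x) ∧ (s ≤ g → x < 0 ∧ x < g) := by
  rw [← prefersFrom_neg, prefersFrom_iff_of_pos (neg_pos.2 hs)]
  simp only [neg_lt_neg_iff, neg_le_neg_iff, neg_pos]

theorem not_prefersFrom_self : ¬ PrefersFrom x s x := fun h =>
  (em (Beyond s x)).elim (fun hx => h.1 hx hx) fun hx => (h.2 hx).2.false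

theorem PrefersFrom.asymm (h : PrefersFrom x s g) (hs : s ≠ 0) (hg : g ≠ 0) (hsg : s ≠ g) :
    ¬ PrefersFrom x g s := by
  wlog hpos : 0 < s generalizing x s g
  · rw [← prefersFrom_neg]
    exact this (prefersFrom_neg.2 h) (neg_ne_zero.2 hs) (neg_ne_zero.2 hg) (neg_injective.ne hsg)
      (by grind)
  rw [prefersFrom_iff_of_pos hpos] at h
  rcases hg.lt_or_gt with hg | hg
  · rw [prefersFrom_iff_of_neg hg]; grind
  · rw [prefersFrom_iff_of_pos hg]; grind

open Classical in
/-- How much farther than to `b` one has to travel to reach the outermost position `X` and return,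
if some point of `G` lies beyond `b`. -/
noncomputable def detour (X : ℝ) (G : Set ℝ) (b : ℝ) : ℝ :=
  if ∃ g ∈ G, Beyond b g then 2 * (X - |b|) else 0

open Classical in
/-- The potential for two runs whose free places differ in one place only: `a` in the first run
takes the role of `b` in the second, and `G` is the set of the other free servers.  It bounds the
extra cost of the first run. -/
noncomputable def potential (X : ℝ) (G : Set ℝ) (a b : ℝ) : ℝ :=
  |a - b| + if Beyond b a then 0 else detour X G b

theorem detour_neg : detour X (-G) (-b) = detour X G b := by
  have : (∃ g ∈ -G, Beyond (-b) g) ↔ ∃ g ∈ G, Beyond b g := by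
    constructor
    · rintro ⟨g, hg, h⟩
      exact ⟨-g, hg, by rwa [← beyond_neg_neg, neg_neg]⟩
    · rintro ⟨g, hg, h⟩
      exact ⟨-g, Set.neg_mem_neg.2 hg, beyond_neg_neg.2 h⟩
  simp only [detour, abs_neg]
  congr 1
  exact propext this

theorem potential_neg : potential X (-G) (-a) (-b) = potential X G a b := by
  simp only [potential, detour_neg, neg_sub_neg, abs_sub_comm b a]
  congr 2
  exact propext beyond_neg_neg

theorem detour_nonneg (hb : |b| ≤ X) : 0 ≤ detour X G b := by
  unfold detour; split_ifs <;> linarith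

theorem detour_le (hb : |b| ≤ X) : detour X G b ≤ 2 * (X - |b|) := by
  unfold detour; split_ifs <;> linarith

theorem detour_mono (hb : |b| ≤ X) (hG : G' ⊆ G) : detour X G' b ≤ detour X G b := by
  by_cases h : ∃ g ∈ G', Beyond b g
  · have h' : ∃ g ∈ G, Beyond b g := h.imp fun g hg => ⟨hG hg.1, hg.2⟩
    simp only [detour, if_pos h, if_pos h', le_refl]
  · simpa only [detour, if_neg h] using detour_nonneg hb

theorem potential_mono (hb : |b| ≤ X) (hG : G' ⊆ G) : potential X G' a b ≤ potential X G a b := by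
  unfold potential
  have := detour_mono hb hG
  split_ifs <;> linarith

theorem abs_sub_le_potential (hb : |b| ≤ X) : |a - b| ≤ potential X G a b := by
  have := detour_nonneg (G := G) hb
  unfold potential; split_ifs <;> linarith

theorem potential_eq_of_beyond (h : Beyond b a) : potential X G a b = |a - b| := by
  simp only [potential, if_pos h, add_zero]

theorem potential_eq_of_forall_not_beyond (h : ∀ g ∈ G, ¬ Beyond b g) :
    potential X G a b = |a - b| := by
  have : ¬ ∃ g ∈ G, Beyond b g := by push Not; exact h
  simp only [potential, detour, if_neg this, ite_self, add_zero]

theorem potential_le (hb : |b| ≤ X) : potential X G a b ≤ |a - b| + 2 * (X - |b|) := by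
  have := detour_le (G := G) hb
  unfold potential; split_ifs <;> linarith

theorem potential_eq_of_mem (ha : ¬ Beyond b a) (hg : g ∈ G) (hbg : Beyond b g) :
    potential X G a b = |a - b| + 2 * (X - |b|) := by
  simp only [potential, detour, if_neg ha, if_pos (⟨g, hg, hbg⟩ : ∃ g ∈ G, Beyond b g)]

theorem potential_move_right_of_pos (hg : g ≠ 0) (hb : 0 < b) (hgX : |g| ≤ X) (hbX : |b| ≤ X)
    (hga : g ≠ a) (hgb : g ≠ b) (hgG : g ∈ G) (hxb : PrefersFrom x b g) (hxa : PrefersFrom x g a)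
    (hxG : ∀ t ∈ G', t ≠ g → PrefersFrom x g t) :
    |x - g| + potential X G' a g ≤ |x - b| + potential X G a b := by
  rw [prefersFrom_iff_of_pos hb] at hxb
  rcases hgb.lt_or_gt with hgb | hbg
  · obtain ⟨hx, hgx⟩ := hxb.2 hgb.le
    have hpot : potential X G' a g = g - a := by
      rcases hg.lt_or_gt with hneg | hpos
      · rw [prefersFrom_iff_of_neg hneg] at hxa
        have hag : a < g := by grind
        rw [potential_eq_of_beyond ((beyond_iff_of_neg hneg).2 hag), abs_sub_comm,
          abs_of_pos (sub_pos.2 hag)]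
      · rw [prefersFrom_iff_of_pos hpos] at hxa
        have hag : a < g := by grind
        rw [potential_eq_of_forall_not_beyond, abs_sub_comm, abs_of_pos (sub_pos.2 hag)]
        intro t ht hgt
        rw [beyond_iff_of_pos hpos] at hgt
        exact ((prefersFrom_iff_of_pos hpos).1 (hxG t ht hgt.ne')).1 hgt |>.not_gt hgx
    rw [hpot, abs_of_pos (sub_pos.2 hgx)]
    linarith [abs_sub_le_potential (a := a) (G := G) hbX, le_abs_self (x - b), neg_le_abs (a - b)]
  · have hg := hb.trans hbg
    have hxb := hxb.1 hbg
    rw [prefersFrom_iff_of_pos hg] at hxa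
    have hxg' : |x - g| = |x - b| + (g - b) := by
      rw [abs_of_nonpos (by linarith), abs_of_nonpos (by linarith)]; ring
    rcases hga.lt_or_gt with hga | hag
    · rw [potential_eq_of_beyond ((beyond_iff_of_pos hg).2 hga),
        potential_eq_of_beyond ((beyond_iff_of_pos hb).2 (hbg.trans hga)), hxg',
        abs_of_pos (sub_pos.2 hga), abs_of_pos (sub_pos.2 (hbg.trans hga))]
      linarith
    · have hax := (hxa.2 hag.le).2
      have hab : a < b := hax.trans_le hxb
      have hle := potential_le (G := G') (a := a) hgX
      rw [potential_eq_of_mem (by rw [beyond_iff_of_pos hb]; exact hab.not_gt) hgG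
        ((beyond_iff_of_pos hb).2 hbg), hxg', abs_of_neg (sub_neg.2 hab), abs_of_pos hb]
      rw [abs_of_neg (sub_neg.2 hag), abs_of_pos hg] at hle
      linarith

/-- The step in which the first run uses a common server `g` and the second its own place `b`. -/
theorem potential_move_right (hg : g ≠ 0) (hb : b ≠ 0) (hgX : |g| ≤ X) (hbX : |b| ≤ X)
    (hga : g ≠ a) (hgb : g ≠ b) (hgG : g ∈ G) (hxb : PrefersFrom x b g) (hxa : PrefersFrom x g a)
    (hxG : ∀ t ∈ G', t ≠ g → PrefersFrom x g t) :
    |x - g| + potential X G' a g ≤ |x - b| + potential X G a b := by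
  rcases hb.lt_or_gt with hneg | hpos
  · have := potential_move_right_of_pos (X := X) (x := -x) (G := -G) (G' := -G')
      (neg_ne_zero.2 hg) (neg_pos.2 hneg) (by rwa [abs_neg]) (by rwa [abs_neg])
      (neg_injective.ne hga) (neg_injective.ne hgb) (Set.neg_mem_neg.2 hgG) (prefersFrom_neg.2 hxb)
      (prefersFrom_neg.2 hxa) (fun t ht htg => by
        rw [← prefersFrom_neg, neg_neg, neg_neg]
        exact hxG _ ht fun h => htg (by rw [← h, neg_neg]))
    simpa only [potential_neg, ← neg_sub', abs_neg] using this
  · exact potential_move_right_of_pos hg hpos hgX hbX hga hgb hgG hxb hxa hxG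

theorem potential_move_left_of_pos_of_lt (ha : a ≠ 0) (hb : 0 < b) (hga : g ≠ a) (hbg : b < g)
    (hxa : PrefersFrom x a g) (hxg : PrefersFrom x g b) :
    |x - a| + potential X G' g b ≤ |x - g| + potential X G a b := by
  have hg := hb.trans hbg
  have hbx := ((prefersFrom_iff_of_pos hg).1 hxg).2 hbg.le
  have hapos : 0 < a := by
    by_contra! hneg
    have := (prefersFrom_iff_of_neg (ha.lt_of_le hneg)).1 hxa
    grind
  rw [prefersFrom_iff_of_pos hapos] at hxa
  have hba : b < a := by grind
  have hmove : |x - a| + (g - a) ≤ |x - g| := by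
    rcases hga.lt_or_gt with hga | hag
    · have := abs_sub_le x g a
      rw [abs_of_neg (sub_neg.2 hga)] at this
      linarith
    · have hxa := hxa.1 hag
      rw [abs_of_nonpos (by linarith), abs_of_nonpos (by linarith)]
      linarith
  rw [potential_eq_of_beyond ((beyond_iff_of_pos hb).2 hbg),
    potential_eq_of_beyond ((beyond_iff_of_pos hb).2 hba), abs_of_pos (sub_pos.2 hbg),
    abs_of_pos (sub_pos.2 hba)]
  linarith

theorem potential_move_left_of_pos (hg : g ≠ 0) (ha : a ≠ 0) (hb : 0 < b) (hbX : |b| ≤ X)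
    (hga : g ≠ a) (hgb : g ≠ b) (hG : G' ⊆ G) (hxa : PrefersFrom x a g) (hxg : PrefersFrom x g b) :
    |x - a| + potential X G' g b ≤ |x - g| + potential X G a b := by
  rcases hgb.lt_or_gt with hgb | hbg
  · have hpot : potential X G' g b ≤ b - g + detour X G b := by
      have := detour_mono hbX hG
      rw [potential, if_neg (by rw [beyond_iff_of_pos hb]; exact hgb.not_gt), abs_sub_comm,
        abs_of_pos (sub_pos.2 hgb)]
      linarith
    suffices hag : a < b ∧ |x - a| ≤ |x - g| + (g - a) by
      have hpot' : potential X G a b = b - a + detour X G b := by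
        rw [potential, if_neg (by rw [beyond_iff_of_pos hb]; exact hag.1.not_gt), abs_sub_comm,
          abs_of_pos (sub_pos.2 hag.1)]
      linarith
    rcases hga.lt_or_gt with hga | hag
    · have hneg : a < 0 := by
        by_contra! hpos
        have := ((prefersFrom_iff_of_pos (ha.symm.lt_of_le hpos)).1 hxa).2 hga.le
        rcases hg.lt_or_gt with hg | hg
        · have := (prefersFrom_iff_of_neg hg).1 hxg
          grind
        · have := (prefersFrom_iff_of_pos hg).1 hxg
          grind
      have hax := ((prefersFrom_iff_of_neg hneg).1 hxa).1 hga
      rw [abs_of_nonneg (by linarith), abs_of_nonneg (by linarith)]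
      exact ⟨hneg.trans hb, by linarith⟩
    · refine ⟨hag.trans hgb, ?_⟩
      simpa only [abs_of_pos (sub_pos.2 hag)] using abs_sub_le x g a
  · exact potential_move_left_of_pos_of_lt ha hb hga hbg hxa hxg

/-- The step in which the first run uses its own place `a` and the second a common server `g`. -/
theorem potential_move_left (hg : g ≠ 0) (ha : a ≠ 0) (hb : b ≠ 0) (hbX : |b| ≤ X)
    (hga : g ≠ a) (hgb : g ≠ b) (hG : G' ⊆ G) (hxa : PrefersFrom x a g)
    (hxg : PrefersFrom x g b) :
    |x - a| + potential X G' g b ≤ |x - g| + potential X G a b := by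
  rcases hb.lt_or_gt with hneg | hpos
  · have := potential_move_left_of_pos (X := X) (x := -x) (G := -G) (G' := -G') (neg_ne_zero.2 hg)
      (neg_ne_zero.2 ha) (neg_pos.2 hneg) (by rwa [abs_neg]) (neg_injective.ne hga)
      (neg_injective.ne hgb) (Set.neg_subset_neg.2 hG)
      (prefersFrom_neg.2 hxa) (prefersFrom_neg.2 hxg)
    simpa only [potential_neg, ← neg_sub', abs_neg] using this
  · exact potential_move_left_of_pos hg ha hpos hbX hga hgb hG hxa hxg

end Line

section TwoSided

variable {ι : Type*} {p crit : ι → ℝ} {r X K : ℝ} {i j o : ι} {G : Set ℝ}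

/-- The point at which PTCP switches between the servers `i` and `j`: the origin if they lie on
different sides of it, and otherwise the critical point `crit` of the inner one of the two. -/
noncomputable def separator (p crit : ι → ℝ) (i j : ι) : ℝ :=
  if p i * p j < 0 then 0 else if |p i| < |p j| then crit i else crit j

/-- A request at `r` goes to the server `i` rather than to `j` only if it lies on the side of `i`
of the point that separates them. -/
def Prefers (p crit : ι → ℝ) (r : ℝ) (i j : ι) : Prop :=
  (p i < p j → r ≤ separator p crit i j) ∧ (p j < p i → separator p crit i j ≤ r)

/-- Servers at distance at least `1` and at most `X` from the origin, where the critical point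
`crit i` just outside the server `i` is so placed that PTCP loses at most a factor `K` by serving a
request at `i` instead of farther out, or farther out instead of at `i`. -/
structure TwoSided (p crit : ι → ℝ) (X K : ℝ) : Prop where
  injective : Function.Injective p
  one_le_abs : ∀ i, 1 ≤ |p i|
  abs_le : ∀ i, |p i| ≤ X
  two_mul_le : 2 * X ≤ K - 1
  beyond_crit : ∀ i j, Beyond (p i) (p j) → Beyond (p i) (crit i)
  inner_le : ∀ i j, Beyond (p i) (p j) → (K + 1) * |crit i - p i| ≤ (K - 1) * |p j - p i|
  outer_le : ∀ i j, Beyond (p i) (p j) → 2 * (X - |p i|) ≤ (K + 1) * |crit i - p i|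

theorem separator_neg : separator (-p) (-crit) i j = -separator p crit i j := by
  simp only [separator, Pi.neg_apply, neg_mul_neg, abs_neg]
  split_ifs <;> simp only [neg_zero]

theorem separator_comm (h : p i ≠ p j) : separator p crit i j = separator p crit j i := by
  simp only [separator, mul_comm (p j)]
  split_ifs with hij hlt hgt hgt
  · rfl
  · exact absurd hlt hgt.not_gt
  · rfl
  · rfl
  · rcases abs_eq_abs.1 (le_antisymm (not_lt.1 hgt) (not_lt.1 hlt)) with hpq | hpq
    · exact absurd hpq h
    · refine absurd ?_ hij
      rw [hpq, neg_mul, neg_lt_zero]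
      exact mul_self_pos.2 fun h0 => h (by rw [hpq, h0, neg_zero])

theorem separator_of_neg_of_lt (hj : p j < 0) (hij : p i < p j) :
    separator p crit i j = crit j := by
  have hi := hij.trans hj
  rw [separator, if_neg (mul_pos_of_neg_of_neg hi hj).not_gt, abs_of_neg hi, abs_of_neg hj,
    if_neg (neg_lt_neg hij).not_gt]

theorem separator_of_pos_of_lt (hi : 0 < p i) (hij : p i < p j) :
    separator p crit i j = crit i := by
  have hj := hi.trans hij
  rw [separator, if_neg (mul_pos hi hj).not_gt, abs_of_pos hi, abs_of_pos hj, if_pos hij]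

theorem separator_of_pos_of_gt (hj : 0 < p j) (hji : p j < p i) :
    separator p crit i j = crit j := by
  have hi := hj.trans hji
  rw [separator, if_neg (mul_pos hi hj).not_gt, abs_of_pos hi, abs_of_pos hj, if_neg hji.not_gt]

theorem separator_of_neg_of_pos (hi : p i < 0) (hj : 0 < p j) : separator p crit i j = 0 :=
  if_pos (mul_neg_of_neg_of_pos hi hj)

theorem separator_of_pos_of_neg (hi : 0 < p i) (hj : p j < 0) : separator p crit i j = 0 :=
  if_pos (mul_neg_of_pos_of_neg hi hj)

theorem prefers_neg : Prefers (-p) (-crit) (-r) i j ↔ Prefers p crit r i j := by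
  simp only [Prefers, separator_neg, Pi.neg_apply, neg_lt_neg_iff, neg_le_neg_iff, and_comm]

theorem TwoSided.neg (h : TwoSided p crit X K) : TwoSided (-p) (-crit) X K where
  injective := neg_injective.comp h.injective
  one_le_abs i := by rw [Pi.neg_apply, abs_neg]; exact h.one_le_abs i
  abs_le i := by rw [Pi.neg_apply, abs_neg]; exact h.abs_le i
  two_mul_le := h.two_mul_le
  beyond_crit i j hij := beyond_neg_neg.2 (h.beyond_crit i j (beyond_neg_neg.1 hij))
  inner_le i j hij := by
    simpa only [Pi.neg_apply, ← neg_sub', abs_neg] using h.inner_le i j (beyond_neg_neg.1 hij)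
  outer_le i j hij := by
    simpa only [Pi.neg_apply, ← neg_sub', abs_neg] using h.outer_le i j (beyond_neg_neg.1 hij)

theorem TwoSided.ne_zero (h : TwoSided p crit X K) (i : ι) : p i ≠ 0 :=
  abs_pos.1 (one_pos.trans_le (h.one_le_abs i))

theorem TwoSided.one_le (h : TwoSided p crit X K) (i : ι) : 1 ≤ K := by
  linarith [h.two_mul_le, (h.one_le_abs i).trans (h.abs_le i)]

theorem TwoSided.crit_lt (h : TwoSided p crit X K) (hi : 0 < p i) (hij : p i < p j) :
    crit i < p j := by
  have hb := (beyond_iff_of_pos hi).2 hij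
  have hcrit := (beyond_iff_of_pos hi).1 (h.beyond_crit i j hb)
  have hle := h.inner_le i j hb
  rw [abs_of_pos (sub_pos.2 hcrit), abs_of_pos (sub_pos.2 hij)] at hle
  nlinarith [h.one_le i]

theorem Prefers.prefersFrom_of_pos (h : TwoSided p crit X K) (hi : 0 < p i)
    (hp : Prefers p crit (p o) i j) (hij : i ≠ j) : PrefersFrom (p o) (p i) (p j) := by
  refine (prefersFrom_iff_of_pos hi).2 ⟨fun hlt => ?_, fun hle => ?_⟩
  · by_contra! ho
    have := hp.1 hlt
    rw [separator_of_pos_of_lt hi hlt] at this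
    exact (h.crit_lt hi ho).not_ge this
  · have hlt := hle.lt_of_ne (h.injective.ne hij.symm)
    have hsep := hp.2 hlt
    rcases (h.ne_zero j).lt_or_gt with hj | hj
    · rw [separator_of_pos_of_neg hi hj] at hsep
      have ho := hsep.lt_of_ne (h.ne_zero o).symm
      exact ⟨ho, hj.trans ho⟩
    · rw [separator_of_pos_of_gt hj hlt] at hsep
      have hcrit := h.beyond_crit j i ((beyond_iff_of_pos hj).2 hlt)
      have ho := ((beyond_iff_of_pos hj).1 hcrit).trans_le hsep
      exact ⟨hj.trans ho, ho⟩

theorem Prefers.prefersFrom (h : TwoSided p crit X K) (hp : Prefers p crit (p o) i j)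
    (hij : i ≠ j) : PrefersFrom (p o) (p i) (p j) := by
  rcases (h.ne_zero i).lt_or_gt with hi | hi
  · exact prefersFrom_neg.1
      (Prefers.prefersFrom_of_pos (p := -p) h.neg (neg_pos.2 hi) (prefers_neg.2 hp) hij)
  · exact Prefers.prefersFrom_of_pos h hi hp hij

theorem TwoSided.potential_start_outward (h : TwoSided p crit X K) (hi : 0 < p i)
    (hij : p i < p j) (hr : r ≤ crit i) (ho : PrefersFrom (p o) (p j) (p i)) :
    |r - p i| + potential X G (p j) (p i) ≤ |p o - p j| + K * |r - p o| := by
  have hio := ((prefersFrom_iff_of_pos (hi.trans hij)).1 ho).2 hij.le |>.2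
  have hbeyond := (beyond_iff_of_pos hi).2 hio
  have hcrit := (beyond_iff_of_pos hi).1 (h.beyond_crit i o hbeyond)
  have hinner := h.inner_le i o hbeyond
  have hro := hr.trans_lt (h.crit_lt hi hio)
  have hK := h.one_le i
  rw [abs_of_pos (sub_pos.2 hcrit), abs_of_pos (sub_pos.2 hio)] at hinner
  rw [potential_eq_of_beyond ((beyond_iff_of_pos hi).2 hij), abs_of_pos (sub_pos.2 hij),
    abs_of_neg (sub_neg.2 hro)]
  have hoj := neg_le_abs (p o - p j)
  rcases le_total r (p i) with hri | hri
  · rw [abs_of_nonpos (sub_nonpos.2 hri)]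
    nlinarith
  · rw [abs_of_nonneg (sub_nonneg.2 hri)]
    nlinarith

theorem TwoSided.potential_start_inward (h : TwoSided p crit X K) (hj : 0 < p j)
    (hji : p j < p i) (hr : crit j ≤ r) (ho : PrefersFrom (p o) (p j) (p i)) :
    |r - p i| + potential X G (p j) (p i) ≤ |p o - p j| + K * |r - p o| := by
  have hoj := ((prefersFrom_iff_of_pos hj).1 ho).1 hji
  have hbeyond := (beyond_iff_of_pos hj).2 hji
  have hcrit := (beyond_iff_of_pos hj).1 (h.beyond_crit j i hbeyond)
  have hinner := h.inner_le j i hbeyond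
  have houter := h.outer_le j i hbeyond
  have hK := h.one_le i
  have hpot := potential_le (G := G) (a := p j) (h.abs_le i)
  rw [abs_of_pos (sub_pos.2 hcrit)] at hinner houter
  rw [abs_of_pos (sub_pos.2 hji)] at hinner
  rw [abs_of_pos hj] at houter
  rw [abs_of_neg (sub_neg.2 hji), abs_of_pos (hj.trans hji)] at hpot
  rw [abs_of_nonpos (sub_nonpos.2 hoj), abs_of_nonneg (a := r - p o) (by linarith)]
  rcases le_total r (p i) with hri | hri
  · rw [abs_of_nonpos (sub_nonpos.2 hri)]
    nlinarith
  · rw [abs_of_nonneg (sub_nonneg.2 hri)]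
    nlinarith

theorem TwoSided.potential_start_across (h : TwoSided p crit X K) (hi : 0 < p i) (hj : p j < 0)
    (hr : 0 ≤ r) (ho : PrefersFrom (p o) (p j) (p i)) :
    |r - p i| + potential X G (p j) (p i) ≤ |p o - p j| + K * |r - p o| := by
  have hneg := ((prefersFrom_iff_of_neg hj).1 ho).2 (hj.trans hi).le |>.1
  have hone := h.one_le_abs o
  have hX := h.two_mul_le
  have hK := h.one_le o
  have hpot := potential_le (G := G) (a := p j) (h.abs_le i)
  have hoj := le_abs_self (p o - p j)
  rw [abs_of_neg hneg] at hone
  rw [abs_of_neg (sub_neg.2 (hj.trans hi)), abs_of_pos hi] at hpot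
  rw [abs_of_nonneg (a := r - p o) (by linarith)]
  rcases le_total r (p i) with hri | hri
  · rw [abs_of_nonpos (sub_nonpos.2 hri)]
    nlinarith
  · rw [abs_of_nonneg (sub_nonneg.2 hri)]
    nlinarith

theorem TwoSided.potential_start_of_pos (h : TwoSided p crit X K) (hi : 0 < p i)
    (hr : Prefers p crit r i j) (ho : PrefersFrom (p o) (p j) (p i)) (hij : i ≠ j) :
    |r - p i| + potential X G (p j) (p i) ≤ |p o - p j| + K * |r - p o| := by
  rcases (h.injective.ne hij).lt_or_gt with hlt | hlt
  · exact h.potential_start_outward hi hlt ((hr.1 hlt).trans_eq (separator_of_pos_of_lt hi hlt)) ho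
  · rcases (h.ne_zero j).lt_or_gt with hj | hj
    · exact h.potential_start_across hi hj ((separator_of_pos_of_neg hi hj).ge.trans (hr.2 hlt)) ho
    · exact h.potential_start_inward hj hlt ((separator_of_pos_of_gt hj hlt).ge.trans (hr.2 hlt)) ho

/-- The first run serves a request at `r` by `i`; the second serves a request at the server `o`
instead, by `j`. -/
theorem TwoSided.potential_start (h : TwoSided p crit X K) (hr : Prefers p crit r i j)
    (ho : PrefersFrom (p o) (p j) (p i)) (hij : i ≠ j) :
    |r - p i| + potential X G (p j) (p i) ≤ |p o - p j| + K * |r - p o| := by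
  rcases (h.ne_zero i).lt_or_gt with hi | hi
  · have := h.neg.potential_start_of_pos (G := -G) (neg_pos.2 hi) (prefers_neg.2 hr)
      (prefersFrom_neg.2 ho) hij
    simpa only [Pi.neg_apply, potential_neg, ← neg_sub', abs_neg] using this
  · exact h.potential_start_of_pos hi hr ho hij

end TwoSided

section Matchings

variable {m : ℕ} {p : Fin m → ℝ} {c : Fin m → ℕ} {σ : List ℝ} {M M' : Matching m}

theorem cost_nonneg (p : Fin m → ℝ) (M : Matching m) : 0 ≤ cost p M :=
  List.sum_nonneg (by simp only [List.mem_map]; rintro _ ⟨e, -, rfl⟩; exact abs_nonneg _)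

theorem exists_isOptimalMatching_of_admissible (p : Fin m → ℝ) (hσ : Admissible c σ) :
    ∃ M, IsOptimalMatching p c σ M := by
  obtain ⟨_, Opt, hOpt, -⟩ := exists_isPermutationAlgorithm p c
  exact ⟨Opt σ, hOpt σ hσ⟩

theorem IsOptimalMatching.optCost_eq (hM : IsOptimalMatching p c σ M) :
    optCost p c σ = cost p M :=
  IsLeast.csInf_eq ⟨Set.mem_image_of_mem _ hM.1, Set.forall_mem_image.2 fun _ => hM.2 _⟩

/-- The number of requests that each server can still take. -/
def room (c : Fin m → ℕ) (M : Matching m) : Fin m → ℕ := c - load M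

theorem mem_free_iff {s : Fin m} : s ∈ free c M ↔ 0 < room c M s := by
  simp only [free, mem_filter, mem_univ, true_and, room, Pi.sub_apply, Nat.sub_pos_iff_lt]

theorem free_congr (h : room c M = room c M') : free c M = free c M' := by
  ext s; rw [mem_free_iff, mem_free_iff, h]

theorem load_snoc (M : Matching m) (r : ℝ) (s : Fin m) :
    load (M ++ [(r, s)]) = load M + Pi.single s 1 := by
  ext t
  simp only [load_append, load_cons, load_nil, zero_add, Pi.add_apply, Pi.single_apply]

theorem cost_snoc (p : Fin m → ℝ) (M : Matching m) (r : ℝ) (s : Fin m) :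
    cost p (M ++ [(r, s)]) = cost p M + |r - p s| := by
  simp [cost]

theorem room_snoc (M : Matching m) (r : ℝ) (s : Fin m) :
    room c (M ++ [(r, s)]) = room c M - Pi.single s 1 := by
  rw [room, room, load_snoc, tsub_add_eq_tsub_tsub]

theorem room_snoc_of_eq_add {r : ℝ} {s : Fin m} {h : Fin m → ℕ}
    (hM : room c M = h + Pi.single s 1) : room c (M ++ [(r, s)]) = h := by
  rw [room_snoc, hM, add_tsub_cancel_right]

theorem exists_eq_add_single {h : Fin m → ℕ} {s : Fin m} (hs : 0 < h s) :
    ∃ h' : Fin m → ℕ, h = h' + Pi.single s 1 :=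
  ⟨h - Pi.single s 1, (tsub_add_cancel_of_le (update_le_iff.2 ⟨hs, fun _ _ => Nat.zero_le _⟩)).symm⟩

theorem OnlineAlgorithm.step_eq (A : OnlineAlgorithm c) (hM : (free c M).Nonempty) (r : ℝ) :
    A.step M r = M ++ [(r, A.pick M r hM)] :=
  dif_pos hM

theorem OnlineAlgorithm.step_eq_self (A : OnlineAlgorithm c) (hM : ¬ (free c M).Nonempty) (r : ℝ) :
    A.step M r = M :=
  dif_neg hM

/-- The cost incurred by `A` when it serves the requests `τ` from the matching `M` on. -/
noncomputable def OnlineAlgorithm.costFrom (A : OnlineAlgorithm c) (p : Fin m → ℝ)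
    (M : Matching m) (τ : List ℝ) : ℝ :=
  cost p (τ.foldl A.step M) - cost p M

theorem OnlineAlgorithm.costFrom_nil (A : OnlineAlgorithm c) : A.costFrom p M [] = 0 :=
  sub_self _

theorem OnlineAlgorithm.costFrom_cons (A : OnlineAlgorithm c) (r : ℝ) (τ : List ℝ) :
    A.costFrom p M (r :: τ) = A.costFrom p M [r] + A.costFrom p (A.step M r) τ := by
  simp only [costFrom, List.foldl_cons, List.foldl_nil]; ring

theorem OnlineAlgorithm.costFrom_cons_of_nonempty (A : OnlineAlgorithm c)
    (hM : (free c M).Nonempty) (r : ℝ) (τ : List ℝ) :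
    A.costFrom p M (r :: τ) =
      |r - p (A.pick M r hM)| + A.costFrom p (M ++ [(r, A.pick M r hM)]) τ := by
  simp only [costFrom, List.foldl_cons, A.step_eq hM, cost_snoc]
  ring

theorem OnlineAlgorithm.costFrom_cons_of_empty (A : OnlineAlgorithm c)
    (hM : ¬ (free c M).Nonempty) (r : ℝ) (τ : List ℝ) :
    A.costFrom p M (r :: τ) = A.costFrom p M τ := by
  simp only [costFrom, List.foldl_cons, A.step_eq_self hM]

end Matchings

section Preference

variable {m : ℕ} {p crit : Fin m → ℝ} {c : Fin m → ℕ} {A : OnlineAlgorithm c} {X K : ℝ}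
  {M M' : Matching m} {h : Fin m → ℕ} {a b g : Fin m} {x : ℝ} {τ : List ℝ}

/-- An online algorithm whose choice depends on the past only through the set of free servers, and
which picks a server that is preferred to all other free ones. -/
structure FollowsPreference (p crit : Fin m → ℝ) (A : OnlineAlgorithm c) : Prop where
  pick_congr : ∀ {M M' : Matching m} (r : ℝ) (hM : (free c M).Nonempty)
    (hM' : (free c M').Nonempty), free c M = free c M' → A.pick M r hM = A.pick M' r hM'
  prefers : ∀ {M : Matching m} (r : ℝ) (hM : (free c M).Nonempty) {s : Fin m},
    s ∈ free c M → A.pick M r hM ≠ s → Prefers p crit r (A.pick M r hM) s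

theorem FollowsPreference.exists_costFrom_cons (hA : FollowsPreference p crit A)
    (hM : (free c M).Nonempty) (r : ℝ) (τ : List ℝ) :
    ∃ s ∈ free c M, A.costFrom p M (r :: τ) = |r - p s| + A.costFrom p (M ++ [(r, s)]) τ ∧
      ∀ t ∈ free c M, s ≠ t → Prefers p crit r s t :=
  ⟨A.pick M r hM, A.pick_mem M r hM, A.costFrom_cons_of_nonempty hM r τ,
    fun _ ht hne => hA.prefers r hM ht hne⟩

theorem FollowsPreference.costFrom_congr (hA : FollowsPreference p crit A) (τ : List ℝ) :
    ∀ {M M' : Matching m}, room c M = room c M' → A.costFrom p M τ = A.costFrom p M' τ := by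
  induction τ with
  | nil => intros; simp only [OnlineAlgorithm.costFrom_nil]
  | cons r τ ih =>
    intro M M' h
    have hfree := free_congr h
    by_cases hM : (free c M).Nonempty
    · have hM' : (free c M').Nonempty := hfree ▸ hM
      rw [A.costFrom_cons_of_nonempty hM, A.costFrom_cons_of_nonempty hM',
        hA.pick_congr r hM hM' hfree,
        ih (M' := M' ++ [(r, A.pick M' r hM')]) (by rw [room_snoc, room_snoc, h])]
    · have hM' : ¬ (free c M').Nonempty := hfree ▸ hM
      rw [A.costFrom_cons_of_empty hM, A.costFrom_cons_of_empty hM', ih h]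

theorem mem_free_of_room_eq (hM : room c M = h + Pi.single a 1) : a ∈ free c M := by
  simp [mem_free_iff, hM]

theorem mem_free_of_pos (hM : room c M = h + Pi.single a 1) {s : Fin m} (hs : 0 < h s) :
    s ∈ free c M := by
  simp only [mem_free_iff, hM, Pi.add_apply]; omega

theorem pos_of_mem_free (hM : room c M = h + Pi.single a 1) {s : Fin m} (hs : s ∈ free c M)
    (hsa : s ≠ a) : 0 < h s := by
  simpa [mem_free_iff, hM, hsa] using hs

/-- The bound of the potential on the extra cost of a run that differs in one free place from
another run on the requests `τ`. -/
def PotentialBounds (A : OnlineAlgorithm c) (p : Fin m → ℝ) (X : ℝ) (τ : List ℝ) : Prop :=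
  ∀ {M M' : Matching m} {h : Fin m → ℕ} {a b : Fin m}, a ≠ b →
    room c M = h + Pi.single a 1 → room c M' = h + Pi.single b 1 →
    A.costFrom p M τ ≤ A.costFrom p M' τ + potential X (p '' Function.support h) (p a) (p b)

theorem image_support_subset (p : Fin m → ℝ) (h k : Fin m → ℕ) :
    p '' Function.support h ⊆ p '' Function.support (h + k) := by
  refine Set.image_mono fun s hs => ?_
  simp only [Function.mem_support, Pi.add_apply] at hs ⊢
  omega

theorem PotentialBounds.costFrom_common (hτ : PotentialBounds A p X τ) (hp : TwoSided p crit X K)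
    (hab : a ≠ b) (hM : room c M = h + Pi.single a 1) (hM' : room c M' = h + Pi.single b 1)
    (hg : 0 < h g) (x : ℝ) :
    A.costFrom p (M ++ [(x, g)]) τ ≤
      A.costFrom p (M' ++ [(x, g)]) τ + potential X (p '' Function.support h) (p a) (p b) := by
  obtain ⟨h, rfl⟩ := exists_eq_add_single hg
  have hrun := hτ hab (room_snoc_of_eq_add (r := x) (hM.trans (add_right_comm _ _ _)))
    (room_snoc_of_eq_add (r := x) (hM'.trans (add_right_comm _ _ _)))
  have hmono := potential_mono (a := p a) (hp.abs_le b)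
    (image_support_subset p h (Pi.single g 1))
  linarith

theorem PotentialBounds.costFrom_left (hτ : PotentialBounds A p X τ) (hp : TwoSided p crit X K)
    (hM : room c M = h + Pi.single a 1) (hM' : room c M' = h + Pi.single b 1)
    (hg : 0 < h g) (hga : g ≠ a) (hgb : g ≠ b) (hxa : PrefersFrom x (p a) (p g))
    (hxg : PrefersFrom x (p g) (p b)) :
    |x - p a| + A.costFrom p (M ++ [(x, a)]) τ ≤ |x - p g| + A.costFrom p (M' ++ [(x, g)]) τ +
      potential X (p '' Function.support h) (p a) (p b) := by
  obtain ⟨h, rfl⟩ := exists_eq_add_single hg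
  have hrun := hτ hgb (room_snoc_of_eq_add (r := x) hM)
    (room_snoc_of_eq_add (r := x) (hM'.trans (add_right_comm _ _ _)))
  have hmove := potential_move_left (hp.ne_zero g) (hp.ne_zero a) (hp.ne_zero b) (hp.abs_le b)
    (hp.injective.ne hga) (hp.injective.ne hgb) (image_support_subset p h (Pi.single g 1)) hxa hxg
  linarith

theorem PotentialBounds.costFrom_right (hτ : PotentialBounds A p X τ) (hp : TwoSided p crit X K)
    (hM : room c M = h + Pi.single a 1) (hM' : room c M' = h + Pi.single b 1)
    (hg : 0 < h g) (hga : g ≠ a) (hgb : g ≠ b)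
    (hxb : PrefersFrom x (p b) (p g)) (hxM : ∀ t ∈ free c M, g ≠ t → PrefersFrom x (p g) (p t)) :
    |x - p g| + A.costFrom p (M ++ [(x, g)]) τ ≤ |x - p b| + A.costFrom p (M' ++ [(x, b)]) τ +
      potential X (p '' Function.support h) (p a) (p b) := by
  obtain ⟨h, rfl⟩ := exists_eq_add_single hg
  have hrun := hτ hga.symm (room_snoc_of_eq_add (r := x) (hM.trans (add_right_comm _ _ _)))
    (room_snoc_of_eq_add (r := x) hM')
  have hxh : ∀ t ∈ p '' Function.support h, t ≠ p g → PrefersFrom x (p g) t := by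
    rintro _ ⟨t, ht, rfl⟩ htg
    refine hxM t (mem_free_of_pos hM ?_) fun hgt => htg (by rw [hgt])
    exact Nat.add_pos_left (Nat.pos_of_ne_zero ht) _
  have hmove := potential_move_right (hp.ne_zero g) (hp.ne_zero b) (hp.abs_le g) (hp.abs_le b)
    (hp.injective.ne hga) (hp.injective.ne hgb)
    (Set.mem_image_of_mem p (Function.mem_support.2 hg.ne')) hxb
    (hxM a (mem_free_of_room_eq hM) hga) hxh
  linarith

theorem FollowsPreference.potentialBounds_cons (hA : FollowsPreference p crit A)
    (hp : TwoSided p crit X K) (hτ : PotentialBounds A p X τ) (o : Fin m) :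
    PotentialBounds A p X (p o :: τ) := by
  intro M M' h a b hab hM hM'
  obtain ⟨s, hs, hcost, hpref⟩ := hA.exists_costFrom_cons ⟨a, mem_free_of_room_eq hM⟩ (p o) τ
  obtain ⟨s', hs', hcost', hpref'⟩ := hA.exists_costFrom_cons ⟨b, mem_free_of_room_eq hM'⟩ (p o) τ
  replace hpref := fun t ht hne => (hpref t ht hne).prefersFrom hp hne
  replace hpref' := fun t ht hne => (hpref' t ht hne).prefersFrom hp hne
  rw [hcost, hcost']
  rcases eq_or_ne s s' with rfl | hss'
  · have hpos : 0 < h s := by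
      rcases eq_or_ne s a with rfl | hsa
      · exact pos_of_mem_free hM' hs' hab
      · exact pos_of_mem_free hM hs hsa
    linarith [hτ.costFrom_common hp hab hM hM' hpos (p o)]
  by_cases hsa : s = a <;> by_cases hsb : s' = b
  · subst hsa hsb
    rw [hA.costFrom_congr τ ((room_snoc_of_eq_add (r := p o) hM).trans
      (room_snoc_of_eq_add (r := p o) hM').symm)]
    have := abs_sub_le_potential (a := p s) (G := p '' Function.support h) (hp.abs_le s')
    linarith [abs_sub_le (p o) (p s') (p s), abs_sub_comm (p s) (p s')]
  · subst hsa
    have hpos := pos_of_mem_free hM' hs' hsb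
    exact hτ.costFrom_left hp hM hM' hpos hss'.symm hsb
      (hpref s' (mem_free_of_pos hM hpos) hss') (hpref' b (mem_free_of_room_eq hM') hsb)
  · subst hsb
    have hpos := pos_of_mem_free hM hs hsa
    exact hτ.costFrom_right hp hM hM' hpos hsa hss'
      (hpref' s (mem_free_of_pos hM' hpos) hss'.symm) hpref
  · exact absurd (hpref' s (mem_free_of_pos hM' (pos_of_mem_free hM hs hsa)) hss'.symm)
      ((hpref s' (mem_free_of_pos hM (pos_of_mem_free hM' hs' hsb)) hss').asymm (hp.ne_zero _)
        (hp.ne_zero _) (hp.injective.ne hss'))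

theorem FollowsPreference.potentialBounds (hA : FollowsPreference p crit A)
    (hp : TwoSided p crit X K) (L : List (Fin m)) : PotentialBounds A p X (L.map p) := by
  induction L with
  | nil =>
    intro M M' h a b _ _ _
    have := abs_sub_le_potential (a := p a) (G := p '' Function.support h) (hp.abs_le b)
    simp only [List.map_nil, A.costFrom_nil, zero_add]
    exact (abs_nonneg _).trans this
  | cons o L ih => exact hA.potentialBounds_cons hp ih o

theorem FollowsPreference.costFrom_cons_le (hA : FollowsPreference p crit A)
    (hp : TwoSided p crit X K) (M : Matching m) (r : ℝ) (o : Fin m) (L : List (Fin m)) :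
    A.costFrom p M (r :: L.map p) ≤ A.costFrom p M (p o :: L.map p) + K * |r - p o| := by
  have hK := hp.one_le o
  by_cases hM : (free c M).Nonempty
  swap
  · rw [A.costFrom_cons_of_empty hM, A.costFrom_cons_of_empty hM]
    nlinarith [abs_nonneg (r - p o)]
  obtain ⟨s, hs, hcost, hpref⟩ := hA.exists_costFrom_cons hM r (L.map p)
  obtain ⟨s', hs', hcost', hpref'⟩ := hA.exists_costFrom_cons hM (p o) (L.map p)
  rw [hcost, hcost']
  rcases eq_or_ne s s' with rfl | hss'
  · rw [hA.costFrom_congr (M' := M ++ [(p o, s)]) _ (by rw [room_snoc, room_snoc])]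
    nlinarith [abs_sub_le r (p o) (p s), abs_nonneg (r - p o)]
  · obtain ⟨h, hh⟩ := exists_eq_add_single (mem_free_iff.1 hs')
    have hpos := pos_of_mem_free hh hs hss'
    obtain ⟨h, rfl⟩ := exists_eq_add_single hpos
    have hrun := hA.potentialBounds hp L hss'.symm
      (room_snoc_of_eq_add (r := r) (hh.trans (add_right_comm _ _ _)))
      (room_snoc_of_eq_add (r := p o) hh)
    have hstart := hp.potential_start (G := p '' Function.support h) (hpref s' hs' hss')
      ((hpref' s hs hss'.symm).prefersFrom hp hss'.symm) hss'
    linarith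

theorem FollowsPreference.costFrom_le_add_mul_cost (hA : FollowsPreference p crit A)
    (hp : TwoSided p crit X K) (N : Matching m) : ∀ M : Matching m,
    A.costFrom p M (N.map Prod.fst) ≤
      A.costFrom p M ((N.map Prod.snd).map p) + K * cost p N := by
  induction N with
  | nil => intro M; simp [A.costFrom_nil, cost]
  | cons e N ih =>
    intro M
    have hfirst := hA.costFrom_cons_le hp M e.1 e.2 (N.map Prod.snd)
    have hrest := ih (A.step M e.1)
    rw [A.costFrom_cons e.1] at hfirst
    simp only [List.map_cons, cost_cons]
    rw [A.costFrom_cons e.1]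
    linarith

theorem FollowsPreference.costFrom_servers_eq_zero (hA : FollowsPreference p crit A)
    (hp : TwoSided p crit X K) (N : Matching m) : ∀ {M : Matching m}, load N ≤ room c M →
    A.costFrom p M ((N.map Prod.snd).map p) = 0 := by
  induction N with
  | nil => intros; exact A.costFrom_nil
  | cons e N ih =>
    intro M hN
    have hload : load (e :: N) = load N + Pi.single e.2 1 := by
      ext t; rw [load_cons, Pi.add_apply, Pi.single_apply]
    rw [hload] at hN
    have hfree : e.2 ∈ free c M :=
      mem_free_iff.2 (lt_of_lt_of_le (by simp) (hN e.2))
    obtain ⟨s, hs, hcost, hpref⟩ :=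
      hA.exists_costFrom_cons ⟨_, hfree⟩ (p e.2) ((N.map Prod.snd).map p)
    obtain rfl : s = e.2 := by
      by_contra hse
      exact not_prefersFrom_self ((hpref e.2 hfree hse).prefersFrom hp hse)
    rw [List.map_cons, List.map_cons, hcost, sub_self, abs_zero, zero_add,
      ih (by rw [room_snoc]; exact le_tsub_of_add_le_right hN)]

theorem FollowsPreference.isCompetitive (hA : FollowsPreference p crit A)
    (hp : TwoSided p crit X K) : IsCompetitive p A K := by
  intro σ hσ
  obtain ⟨N, hN⟩ := exists_isOptimalMatching_of_admissible p hσ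
  have hzero : A.costFrom p [] ((N.map Prod.snd).map p) = 0 :=
    hA.costFrom_servers_eq_zero hp N hN.1.2
  have hle := hA.costFrom_le_add_mul_cost hp N []
  rw [hzero, hN.1.1, zero_add] at hle
  rw [hN.optCost_eq]
  simpa [OnlineAlgorithm.costFrom, OnlineAlgorithm.run, cost] using hle

end Preference

section Recursion

variable {m : ℕ} {p : Fin m → ℝ} {r : ℝ} {S F : Finset (Fin m)} {s g : Fin m}

theorem ptcpServer_eq_left {hFS : F ⊆ S} {hF : F.Nonempty} (hcard : F.card ≠ 1) (h : 2 ≤ S.card)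
    (hL : r ≤ criticalPoint p S h ∨ F ∩ rightPart p S h = ∅)
    (hne : (F ∩ leftPart p S h).Nonempty) :
    (ptcpServer p r S F hFS hF).1 =
      (ptcpServer p r (leftPart p S h) (F ∩ leftPart p S h) inter_subset_right hne).1 := by
  rw [ptcpServer, dif_neg hcard, dif_pos (hL.imp_left fun hr => ⟨hr, hne⟩)]

theorem ptcpServer_eq_right {hFS : F ⊆ S} {hF : F.Nonempty} (hcard : F.card ≠ 1) (h : 2 ≤ S.card)
    (hL : (F ∩ leftPart p S h).Nonempty → criticalPoint p S h < r)
    (hne : (F ∩ rightPart p S h).Nonempty) :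
    (ptcpServer p r S F hFS hF).1 =
      (ptcpServer p r (rightPart p S h) (F ∩ rightPart p S h) inter_subset_right hne).1 := by
  rw [ptcpServer, dif_neg hcard, dif_neg]
  rintro (⟨hr, hl⟩ | he)
  · exact (hL hl).not_ge hr
  · exact hne.ne_empty he

/-- The server sets that occur in the recursion of PTCP. -/
inductive PtcpNode (p : Fin m → ℝ) : Finset (Fin m) → Prop
  | root : PtcpNode p univ
  | left {S : Finset (Fin m)} (h : 2 ≤ S.card) : PtcpNode p S → PtcpNode p (leftPart p S h)
  | right {S : Finset (Fin m)} (h : 2 ≤ S.card) : PtcpNode p S → PtcpNode p (rightPart p S h)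

theorem PtcpNode.exists_split (hS : PtcpNode p S) (hFS : F ⊆ S) (hF : F.Nonempty) (hg : g ∈ F)
    (hne : (ptcpServer p r S F hFS hF).1 ≠ g) : ∃ (T : Finset (Fin m)) (h : 2 ≤ T.card),
      PtcpNode p T ∧
        ((ptcpServer p r S F hFS hF).1 ∈ leftPart p T h ∧ g ∈ rightPart p T h ∧
            r ≤ criticalPoint p T h ∨
          (ptcpServer p r S F hFS hF).1 ∈ rightPart p T h ∧ g ∈ leftPart p T h ∧
            criticalPoint p T h ≤ r) := by
  induction hcard : S.card using Nat.strong_induction_on generalizing S F with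
  | _ n ih =>
  subst hcard
  have hsF := (ptcpServer p r S F hFS hF).2
  have hF2 : 1 < F.card := one_lt_card.2 ⟨_, hsF, g, hg, hne⟩
  have h : 2 ≤ S.card := hF2.trans_le (card_le_card hFS)
  by_cases hL : (F ∩ leftPart p S h).Nonempty ∧
      (r ≤ criticalPoint p S h ∨ F ∩ rightPart p S h = ∅)
  · have heq := ptcpServer_eq_left (hFS := hFS) (hF := hF) hF2.ne' h hL.2 hL.1
    rw [heq] at hne ⊢
    have hs := (ptcpServer p r _ _ inter_subset_right hL.1).2
    rcases left_or_right p S h (hFS hg) with hgl | hgr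
    · exact ih _ (leftPart_card_lt p S h) (hS.left h) inter_subset_right hL.1
        (mem_inter.2 ⟨hg, hgl⟩) hne rfl
    · refine ⟨S, h, hS, Or.inl ⟨(mem_inter.1 hs).2, hgr, hL.2.resolve_right ?_⟩⟩
      exact ne_empty_of_mem (mem_inter.2 ⟨hg, hgr⟩)
  · have hR : (F ∩ rightPart p S h).Nonempty := by
      by_contra! hR
      have hgl := (left_or_right p S h (hFS hg)).resolve_right fun hgr =>
        ne_empty_of_mem (mem_inter.2 ⟨hg, hgr⟩) hR
      exact hL ⟨⟨g, mem_inter.2 ⟨hg, hgl⟩⟩, Or.inr hR⟩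
    have hcrit : (F ∩ leftPart p S h).Nonempty → criticalPoint p S h < r := fun hl =>
      not_le.1 fun hr => hL ⟨hl, Or.inl hr⟩
    have heq := ptcpServer_eq_right (hFS := hFS) (hF := hF) hF2.ne' h hcrit hR
    rw [heq] at hne ⊢
    have hs := (ptcpServer p r _ _ inter_subset_right hR).2
    rcases left_or_right p S h (hFS hg) with hgl | hgr
    · exact ⟨S, h, hS, Or.inr ⟨(mem_inter.1 hs).2, hgl, (hcrit ⟨g, mem_inter.2 ⟨hg, hgl⟩⟩).le⟩⟩
    · exact ih _ (rightPart_card_lt p S h) (hS.right h) inter_subset_right hR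
        (mem_inter.2 ⟨hg, hgr⟩) hne rfl

theorem splitPair_eq (h : 2 ≤ S.card) {q : Fin m × Fin m} (hq : q ∈ adjacentPairs S)
    (hmax : ∀ q' ∈ adjacentPairs S, q' ≠ q → p q'.2 - p q'.1 < p q.2 - p q.1) :
    splitPair p S h = q := by
  by_contra hne
  obtain ⟨hmem, hle⟩ := splitPair_spec p S h
  exact (hmax _ hmem hne).not_ge (hle q hq)

theorem add_one_eq_of_mem_adjacentPairs (hS : (S : Set (Fin m)).OrdConnected) {q : Fin m × Fin m}
    (hq : q ∈ adjacentPairs S) : (q.1 : ℕ) + 1 = q.2 := by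
  simp only [adjacentPairs, mem_filter, mem_product] at hq
  obtain ⟨⟨h1, h2⟩, hlt, hadj⟩ := hq
  refine (Nat.covBy_iff_add_one_eq.1 (Fin.covBy_iff.1 ⟨hlt, fun t ht ht' => ?_⟩))
  exact (hadj t (hS.out h1 h2 ⟨ht.le, ht'.le⟩)).elim ht.not_ge ht'.not_ge

theorem splitPair_eq_of_ordConnected (h : 2 ≤ S.card) (hS : (S : Set (Fin m)).OrdConnected)
    {i j : Fin m} (hi : i ∈ S) (hj : j ∈ S) (hij : (i : ℕ) + 1 = j)
    (hmax : ∀ a b : Fin m, a ∈ S → b ∈ S → (a : ℕ) + 1 = b → a ≠ i → p b - p a < p j - p i) :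
    splitPair p S h = (i, j) := by
  have hadj : (i, j) ∈ adjacentPairs S := by
    simp only [adjacentPairs, mem_filter, mem_product, Fin.lt_def, Fin.le_def]
    exact ⟨⟨hi, hj⟩, by omega, fun t _ => by omega⟩
  refine splitPair_eq h hadj fun q hq hne => ?_
  have hsucc := add_one_eq_of_mem_adjacentPairs hS hq
  obtain ⟨h1, h2⟩ := mem_product.1 (mem_filter.1 hq).1
  refine hmax _ _ h1 h2 hsucc fun hqi => hne (Prod.ext hqi (Fin.ext ?_))
  rw [← hsucc, hqi, hij]

theorem criticalPoint_eq (h : 2 ≤ S.card) {l u a b : Fin m} (hl : IsLeast (S : Set (Fin m)) l)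
    (hu : IsGreatest (S : Set (Fin m)) u) (hab : splitPair p S h = (a, b)) :
    criticalPoint p S h = p a + (p u - p a) / ((p b - p l) + (p u - p a)) * (p b - p a) := by
  have hS : S.Nonempty := ⟨l, hl.1⟩
  simp only [criticalPoint, hab, (S.isLeast_min' hS).unique hl, (S.isGreatest_max' hS).unique hu]
  ring

theorem ptcpServer_congr {F' : Finset (Fin m)} {hFS : F ⊆ S} {hF : F.Nonempty} {hFS' : F' ⊆ S}
    {hF' : F'.Nonempty} (h : F = F') :
    (ptcpServer p r S F hFS hF).1 = (ptcpServer p r S F' hFS' hF').1 := by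
  subst h; rfl

theorem ptcp_followsPreference {crit : Fin m → ℝ} (hp : StrictMono p)
    (hcrit : ∀ {T : Finset (Fin m)} (h : 2 ≤ T.card), PtcpNode p T → ∀ {i j : Fin m},
      i ∈ leftPart p T h → j ∈ rightPart p T h → criticalPoint p T h = separator p crit i j)
    (c : Fin m → ℕ) : FollowsPreference p crit (ptcp p c) where
  pick_congr _ _ _ h := ptcpServer_congr h
  prefers {M} r hM g hg hne := by
    have hlt : ∀ {T : Finset (Fin m)} (h : 2 ≤ T.card) {i j : Fin m},
        i ∈ leftPart p T h → j ∈ rightPart p T h → p i < p j := by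
      intro T h i j hi hj
      have hsplit := (splitPair_spec p T h).1
      simp only [adjacentPairs, mem_filter] at hsplit
      exact hp ((mem_filter.1 hi).2.trans_lt (hsplit.2.1.trans_le (mem_filter.1 hj).2))
    obtain ⟨T, h, hT, ⟨hs, hg, hr⟩ | ⟨hs, hg, hr⟩⟩ :=
      PtcpNode.root.exists_split (subset_univ _) hM hg hne
    · exact ⟨fun _ => hr.trans_eq (hcrit h hT hs hg), fun hgs => absurd hgs (hlt h hs hg).not_gt⟩
    · refine ⟨fun hsg => absurd hsg (hlt h hg hs).not_gt, fun hgs => ?_⟩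
      rw [separator_comm hgs.ne']
      exact (hcrit h hT hg hs).symm.trans_le hr

end Recursion

section Layout

variable {k e : ℕ} {δ K : ℝ} {i j : Fin (2 * k)} {S : Finset (Fin (2 * k))}

/-- The distance from the origin of the `e`-th server on either side. -/
noncomputable def radius (δ : ℝ) (e : ℕ) : ℝ := (1 - δ ^ e) / (1 - δ)

theorem radius_succ (h1 : δ < 1) (e : ℕ) : radius δ (e + 1) = radius δ e + δ ^ e := by
  have : 1 - δ ≠ 0 := (sub_pos.2 h1).ne'
  simp only [radius]
  field_simp
  ring

theorem radius_one (h1 : δ < 1) : radius δ 1 = 1 := by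
  rw [radius, pow_one, div_self (sub_pos.2 h1).ne']

theorem radius_strictMono (h0 : 0 < δ) (h1 : δ < 1) : StrictMono (radius δ) :=
  strictMono_nat_of_lt_succ fun e => by
    rw [radius_succ h1]
    exact lt_add_of_pos_right _ (pow_pos h0 e)

theorem one_le_radius (h0 : 0 < δ) (h1 : δ < 1) (he : 1 ≤ e) : 1 ≤ radius δ e := by
  rw [← radius_one h1]
  exact (radius_strictMono h0 h1).monotone he

theorem radius_sub_le (h0 : 0 < δ) (h1 : δ < 1) (k e : ℕ) :
    radius δ k - radius δ e ≤ δ ^ e * (1 - δ)⁻¹ := by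
  rw [radius, radius, ← sub_div, ← div_eq_mul_inv]
  exact div_le_div_of_nonneg_right (by linarith [pow_pos h0 k]) (sub_pos.2 h1).le

/-- The distance from the origin of the critical point of PTCP just outside the `e`-th server of a
side with `k` servers; `δ ^ e` is the gap behind this server and `radius δ k - radius δ e` the
length of the rest of the side. -/
noncomputable def criticalRadius (k : ℕ) (δ : ℝ) (e : ℕ) : ℝ :=
  radius δ e + δ ^ e * (radius δ k - radius δ e) / (δ ^ e + (radius δ k - radius δ e))

theorem radius_lt_criticalRadius (h0 : 0 < δ) (h1 : δ < 1) (he : e < k) :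
    radius δ e < criticalRadius k δ e := by
  have hgap := pow_pos h0 e
  have hrest := sub_pos.2 (radius_strictMono h0 h1 he)
  exact lt_add_of_pos_right _ (div_pos (mul_pos hgap hrest) (add_pos hgap hrest))

theorem criticalRadius_sub_le (h0 : 0 < δ) (h1 : δ < 1) (hK : 2 * (1 - δ)⁻¹ ≤ K - 1)
    (he : e < k) : (K + 1) * (criticalRadius k δ e - radius δ e) ≤ (K - 1) * δ ^ e := by
  have hgap := pow_pos h0 e
  have hrest := sub_pos.2 (radius_strictMono h0 h1 he)
  have hK' : 2 * (radius δ k - radius δ e) ≤ (K - 1) * δ ^ e := by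
    nlinarith [radius_sub_le h0 h1 k e]
  rw [criticalRadius, add_sub_cancel_left, ← mul_div_assoc, div_le_iff₀ (add_pos hgap hrest)]
  nlinarith

theorem le_criticalRadius_sub (h0 : 0 < δ) (h1 : δ < 1) (hK : 2 * (1 - δ)⁻¹ ≤ K - 1)
    (he : e < k) :
    2 * (radius δ k - radius δ e) ≤ (K + 1) * (criticalRadius k δ e - radius δ e) := by
  have hgap := pow_pos h0 e
  have hrest := sub_pos.2 (radius_strictMono h0 h1 he)
  have hK' : 2 * (radius δ k - radius δ e) ≤ (K - 1) * δ ^ e := by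
    nlinarith [radius_sub_le h0 h1 k e]
  rw [criticalRadius, add_sub_cancel_left, ← mul_div_assoc, le_div_iff₀ (add_pos hgap hrest)]
  nlinarith

/-- The critical point just outside each server of the layout. -/
noncomputable def layoutCritical (k : ℕ) (δ : ℝ) (j : Fin (2 * k)) : ℝ :=
  if (j : ℕ) < k then -criticalRadius k δ (k - j) else criticalRadius k δ (j + 1 - k)

theorem layout_of_le (h : k ≤ j) : layout k δ j = radius δ (j + 1 - k) :=
  if_neg h.not_gt

theorem layout_of_lt (h : j < k) : layout k δ j = -radius δ (k - j) :=
  if_pos h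

theorem layoutCritical_of_le (h : k ≤ j) :
    layoutCritical k δ j = criticalRadius k δ (j + 1 - k) :=
  if_neg h.not_gt

theorem layoutCritical_of_lt (h : j < k) : layoutCritical k δ j = -criticalRadius k δ (k - j) :=
  if_pos h

theorem layout_rev (δ : ℝ) (j : Fin (2 * k)) : layout k δ j.rev = -layout k δ j := by
  have hrev := j.val_rev
  rcases lt_or_ge (j : ℕ) k with hj | hj
  · rw [layout_of_lt hj, layout_of_le (by omega), neg_neg]
    congr 1; omega
  · rw [layout_of_le hj, layout_of_lt (by omega)]
    congr 2; omega

theorem layoutCritical_rev (δ : ℝ) (j : Fin (2 * k)) :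
    layoutCritical k δ j.rev = -layoutCritical k δ j := by
  have hrev := j.val_rev
  rcases lt_or_ge (j : ℕ) k with hj | hj
  · rw [layoutCritical_of_lt hj, layoutCritical_of_le (by omega), neg_neg]
    congr 1; omega
  · rw [layoutCritical_of_le hj, layoutCritical_of_lt (by omega)]
    congr 2; omega

theorem one_le_layout (h0 : 0 < δ) (h1 : δ < 1) (hj : k ≤ j) : 1 ≤ layout k δ j := by
  rw [layout_of_le hj]
  exact one_le_radius h0 h1 (by omega)

theorem layout_le_neg_one (h0 : 0 < δ) (h1 : δ < 1) (hj : j < k) : layout k δ j ≤ -1 := by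
  rw [layout_of_lt hj]
  exact neg_le_neg (one_le_radius h0 h1 (by omega))

theorem layout_strictMono (h0 : 0 < δ) (h1 : δ < 1) : StrictMono (layout k δ) := by
  intro i j hij
  have hij' := Fin.lt_def.1 hij
  rcases lt_or_ge (j : ℕ) k with hj | hj
  · rw [layout_of_lt hj, layout_of_lt (hij'.trans hj), neg_lt_neg_iff]
    exact radius_strictMono h0 h1 (by omega)
  rcases lt_or_ge (i : ℕ) k with hi | hi
  · linarith [layout_le_neg_one h0 h1 hi, one_le_layout h0 h1 hj]
  · rw [layout_of_le hi, layout_of_le hj]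
    exact radius_strictMono h0 h1 (by omega)

theorem abs_layout_mem_Icc (h0 : 0 < δ) (h1 : δ < 1) (j : Fin (2 * k)) :
    |layout k δ j| ∈ Set.Icc 1 (radius δ k) := by
  have hmono := (radius_strictMono h0 h1).monotone
  rcases lt_or_ge (j : ℕ) k with hj | hj
  · have hle := layout_le_neg_one h0 h1 hj
    rw [abs_of_neg (by linarith), layout_of_lt hj, neg_neg]
    exact ⟨one_le_radius h0 h1 (by omega), hmono (by omega)⟩
  · have hle := one_le_layout h0 h1 hj
    rw [abs_of_pos (by linarith), layout_of_le hj]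
    exact ⟨one_le_radius h0 h1 (by omega), hmono (by omega)⟩

theorem layoutCritical_bounds_of_le (h0 : 0 < δ) (h1 : δ < 1) (hK : 2 * (1 - δ)⁻¹ ≤ K - 1)
    (hi : k ≤ i) (hij : i < j) :
    layout k δ i < layoutCritical k δ i ∧
      (K + 1) * (layoutCritical k δ i - layout k δ i) ≤
        (K - 1) * (layout k δ j - layout k δ i) ∧
      2 * (radius δ k - layout k δ i) ≤ (K + 1) * (layoutCritical k δ i - layout k δ i) := by
  have hij' := Fin.lt_def.1 hij
  have he : (i : ℕ) + 1 - k < k := by omega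
  have hgap : δ ^ ((i : ℕ) + 1 - k) ≤ layout k δ j - layout k δ i := by
    rw [layout_of_le hi, layout_of_le (hi.trans hij'.le), le_sub_iff_add_le', ← radius_succ h1]
    exact (radius_strictMono h0 h1).monotone (by omega)
  have hinv := inv_pos.2 (sub_pos.2 h1)
  rw [layout_of_le hi] at hgap ⊢
  rw [layoutCritical_of_le hi]
  exact ⟨radius_lt_criticalRadius h0 h1 he, (criticalRadius_sub_le h0 h1 hK he).trans
    (mul_le_mul_of_nonneg_left hgap (by linarith)), le_criticalRadius_sub h0 h1 hK he⟩

theorem layoutCritical_bounds (h0 : 0 < δ) (h1 : δ < 1) (hK : 2 * (1 - δ)⁻¹ ≤ K - 1)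
    (hij : Beyond (layout k δ i) (layout k δ j)) :
    Beyond (layout k δ i) (layoutCritical k δ i) ∧
      (K + 1) * |layoutCritical k δ i - layout k δ i| ≤
        (K - 1) * |layout k δ j - layout k δ i| ∧
      2 * (radius δ k - |layout k δ i|) ≤ (K + 1) * |layoutCritical k δ i - layout k δ i| := by
  wlog hi : k ≤ i generalizing i j
  · have hrev := i.val_rev
    simpa only [layout_rev, layoutCritical_rev, beyond_neg_neg, ← neg_sub', abs_neg] using
      this (i := i.rev) (j := j.rev) (by rwa [layout_rev, layout_rev, beyond_neg_neg]) (by omega)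
  have hpos := one_pos.trans_le (one_le_layout h0 h1 hi)
  rw [beyond_iff_of_pos hpos] at hij ⊢
  have hbounds := layoutCritical_bounds_of_le h0 h1 hK hi
    ((layout_strictMono h0 h1).lt_iff_lt.1 hij)
  rwa [abs_of_pos (sub_pos.2 hbounds.1), abs_of_pos (sub_pos.2 hij), abs_of_pos hpos]

theorem twoSided_layout (h0 : 0 < δ) (h1 : δ < 1) (hK : 2 * (1 - δ)⁻¹ ≤ K - 1) :
    TwoSided (layout k δ) (layoutCritical k δ) (radius δ k) K where
  injective := (layout_strictMono h0 h1).injective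
  one_le_abs j := (abs_layout_mem_Icc h0 h1 j).1
  abs_le j := (abs_layout_mem_Icc h0 h1 j).2
  two_mul_le := by
    have := radius_sub_le h0 h1 k 0
    simp only [radius, pow_zero, sub_self, zero_div, sub_zero, one_mul] at this ⊢
    linarith
  beyond_crit _ _ h := (layoutCritical_bounds h0 h1 hK h).1
  inner_le _ _ h := (layoutCritical_bounds h0 h1 hK h).2.1
  outer_le _ _ h := (layoutCritical_bounds h0 h1 hK h).2.2

theorem layout_sub_of_le (h1 : δ < 1) (hi : k ≤ i) (hij : (i : ℕ) + 1 = j) :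
    layout k δ j - layout k δ i = δ ^ ((i : ℕ) + 1 - k) := by
  rw [layout_of_le hi, layout_of_le (by omega), show (j : ℕ) + 1 - k = i + 1 - k + 1 by omega,
    radius_succ h1, add_sub_cancel_left]

theorem layout_sub_of_lt (h1 : δ < 1) (hj : j < k) (hij : (i : ℕ) + 1 = j) :
    layout k δ j - layout k δ i = δ ^ (k - (j : ℕ)) := by
  rw [layout_of_lt hj, layout_of_lt (by omega), show k - (i : ℕ) = k - j + 1 by omega,
    radius_succ h1]
  ring

theorem layout_sub_of_eq (h1 : δ < 1) (hj : j = k) (hij : (i : ℕ) + 1 = j) :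
    layout k δ j - layout k δ i = 2 := by
  rw [layout_of_le hj.ge, layout_of_lt (by omega), show (j : ℕ) + 1 - k = 1 by omega,
    show k - (i : ℕ) = 1 by omega, radius_one h1]
  norm_num

theorem exists_splitPair_layout_univ (h0 : 0 < δ) (h1 : δ < 1)
    (h : 2 ≤ (univ : Finset (Fin (2 * k))).card) : ∃ i j : Fin (2 * k), (j : ℕ) = k ∧
      (i : ℕ) + 1 = j ∧ splitPair (layout k δ) univ h = (i, j) := by
  have hcard := h
  rw [card_univ, Fintype.card_fin] at hcard
  have hij : k - 1 + 1 = k := Nat.sub_add_cancel (by omega)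
  let i : Fin (2 * k) := ⟨k - 1, by omega⟩
  let j : Fin (2 * k) := ⟨k, by omega⟩
  refine ⟨i, j, rfl, hij, ?_⟩
  refine splitPair_eq_of_ordConnected h (by rw [coe_univ]; exact Set.ordConnected_univ)
    (mem_univ i) (mem_univ j) hij fun a b _ _ hab hne => ?_
  have hne' : (a : ℕ) ≠ k - 1 := Fin.val_ne_of_ne hne
  rw [layout_sub_of_eq (i := i) (j := j) h1 rfl hij]
  rcases lt_or_ge (b : ℕ) k with hb | hb
  · rw [layout_sub_of_lt h1 hb hab]
    exact (pow_le_one₀ h0.le h1.le).trans_lt one_lt_two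
  · rw [layout_sub_of_le h1 (by omega) hab]
    exact (pow_le_one₀ h0.le h1.le).trans_lt one_lt_two

theorem exists_splitPair_layout_Ici (h0 : 0 < δ) (h1 : δ < 1) (h : 2 ≤ (Ici i).card) (hi : k ≤ i) :
    ∃ j : Fin (2 * k), (i : ℕ) + 1 = j ∧ splitPair (layout k δ) (Ici i) h = (i, j) := by
  have hcard := h
  rw [Fin.card_Ici] at hcard
  refine ⟨⟨i + 1, by omega⟩, rfl, ?_⟩
  refine splitPair_eq_of_ordConnected h (by rw [coe_Ici]; exact Set.ordConnected_Ici)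
    (mem_Ici.2 le_rfl) (mem_Ici.2 (Nat.le_succ i)) rfl fun a b ha _ hab hne => ?_
  rw [mem_Ici, Fin.le_def] at ha
  rw [layout_sub_of_le h1 (by omega) hab, layout_sub_of_le h1 hi rfl]
  exact pow_lt_pow_right_of_lt_one₀ h0 h1 (by omega)

theorem exists_splitPair_layout_Iic (h0 : 0 < δ) (h1 : δ < 1) (h : 2 ≤ (Iic j).card) (hj : j < k) :
    ∃ i : Fin (2 * k), (i : ℕ) + 1 = j ∧ splitPair (layout k δ) (Iic j) h = (i, j) := by
  have hcard := h
  rw [Fin.card_Iic] at hcard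
  have hij : (j : ℕ) - 1 + 1 = j := Nat.sub_add_cancel (by omega)
  refine ⟨⟨j - 1, by omega⟩, hij, ?_⟩
  refine splitPair_eq_of_ordConnected h (by rw [coe_Iic]; exact Set.ordConnected_Iic)
    (mem_Iic.2 (Nat.sub_le j 1)) (mem_Iic.2 le_rfl) hij fun a b _ hb hab hne => ?_
  rw [mem_Iic, Fin.le_def] at hb
  have hne' : (a : ℕ) ≠ j - 1 := Fin.val_ne_of_ne hne
  rw [layout_sub_of_lt h1 (by omega) hab, layout_sub_of_lt h1 hj hij]
  exact pow_lt_pow_right_of_lt_one₀ h0 h1 (by omega)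

theorem criticalPoint_layout_univ (h0 : 0 < δ) (h1 : δ < 1)
    (h : 2 ≤ (univ : Finset (Fin (2 * k))).card) : criticalPoint (layout k δ) univ h = 0 := by
  obtain ⟨i, j, hj, hij, hsplit⟩ := exists_splitPair_layout_univ h0 h1 h
  have hk : 1 ≤ k := by omega
  let l : Fin (2 * k) := ⟨0, by omega⟩
  have hi : layout k δ i = -1 := by
    rw [layout_of_lt (by omega), show k - (i : ℕ) = 1 by omega, radius_one h1]
  have hgap := layout_sub_of_eq h1 hj hij
  have hR := one_le_radius h0 h1 hk
  rw [criticalPoint_eq h ⟨mem_univ l, fun t _ => Nat.zero_le t⟩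
      ⟨mem_univ l.rev, fun t _ => Fin.le_rev_iff.2 (Nat.zero_le _)⟩ hsplit, hgap, layout_rev,
    layout_of_lt (j := l) hk, show layout k δ j = 1 by linarith, hi, Nat.sub_zero]
  simp only [sub_neg_eq_add, neg_neg, add_comm (1 : ℝ), ← two_mul]
  have hsum : radius δ k + 1 ≠ 0 := by linarith
  field_simp
  ring

theorem criticalPoint_layout_Ici (h0 : 0 < δ) (h1 : δ < 1) (h : 2 ≤ (Ici i).card) (hi : k ≤ i) :
    criticalPoint (layout k δ) (Ici i) h = layoutCritical k δ i := by
  obtain ⟨j, hij, hsplit⟩ := exists_splitPair_layout_Ici h0 h1 h hi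
  have hk : 0 < k := by omega
  let l : Fin (2 * k) := ⟨0, by omega⟩
  have hu : ∀ t, t ≤ l.rev := fun t => Fin.le_rev_iff.2 (Nat.zero_le _)
  rw [criticalPoint_eq h (by rw [coe_Ici]; exact isLeast_Ici) ⟨mem_Ici.2 (hu i), fun t _ => hu t⟩
      hsplit, layout_sub_of_le h1 hi hij, layout_rev, layout_of_lt (j := l) hk, neg_neg,
    layoutCritical_of_le hi, layout_of_le hi, criticalRadius, mul_comm (δ ^ _),
    mul_div_right_comm, Nat.sub_zero]

theorem criticalPoint_layout_Iic (h0 : 0 < δ) (h1 : δ < 1) (h : 2 ≤ (Iic j).card) (hj : j < k) :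
    criticalPoint (layout k δ) (Iic j) h = layoutCritical k δ j := by
  obtain ⟨i, hij, hsplit⟩ := exists_splitPair_layout_Iic h0 h1 h hj
  have hk : 0 < k := by omega
  let l : Fin (2 * k) := ⟨0, by omega⟩
  have hgap := layout_sub_of_lt h1 hj hij
  have hi : layout k δ i = -radius δ (k - j) - δ ^ (k - (j : ℕ)) := by
    rw [← hgap, layout_of_lt hj]; ring
  have hD := pow_pos h0 (k - (j : ℕ))
  have hL := (radius_strictMono h0 h1).monotone (Nat.sub_le k j)
  rw [criticalPoint_eq (l := l) h ⟨mem_Iic.2 (Nat.zero_le _), fun t _ => Nat.zero_le _⟩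
      (by rw [coe_Iic]; exact isGreatest_Iic) hsplit, hgap, hi, layout_of_lt (j := l) hk,
    layout_of_lt hj, layoutCritical_of_lt hj, criticalRadius, Nat.sub_zero]
  have hsum : δ ^ (k - (j : ℕ)) + (radius δ k - radius δ (k - j)) ≠ 0 := by linarith
  have hsum' : -radius δ (k - j) - -radius δ k + δ ^ (k - (j : ℕ)) ≠ 0 := by linarith
  field_simp
  ring

theorem PtcpNode.layout_cases (h0 : 0 < δ) (h1 : δ < 1) (hS : PtcpNode (layout k δ) S)
    (h : 2 ≤ S.card) : S = univ ∨ (∃ i : Fin (2 * k), k ≤ i ∧ S = Ici i) ∨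
      ∃ j : Fin (2 * k), j < k ∧ S = Iic j := by
  induction hS with
  | root => exact Or.inl rfl
  | left hcard _ ih =>
    rcases ih hcard with rfl | ⟨i, hi, rfl⟩ | ⟨j, hj, rfl⟩
    · obtain ⟨i, j, hj, hij, hsplit⟩ := exists_splitPair_layout_univ h0 h1 hcard
      refine Or.inr (Or.inr ⟨i, by omega, ?_⟩)
      ext t; simp [leftPart, hsplit]
    · obtain ⟨j, -, hsplit⟩ := exists_splitPair_layout_Ici h0 h1 hcard hi
      have hsub : leftPart (layout k δ) (Ici i) hcard ⊆ {i} := fun t ht => by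
        simp only [leftPart, hsplit, mem_filter, mem_Ici] at ht
        exact mem_singleton.2 (le_antisymm ht.2 ht.1)
      have := card_le_card hsub
      rw [card_singleton] at this
      omega
    · obtain ⟨i, hij, hsplit⟩ := exists_splitPair_layout_Iic h0 h1 hcard hj
      refine Or.inr (Or.inr ⟨i, by omega, ?_⟩)
      ext t; simp only [leftPart, hsplit, mem_filter, mem_Iic, Fin.le_def]; omega
  | right hcard _ ih =>
    rcases ih hcard with rfl | ⟨i, hi, rfl⟩ | ⟨j, hj, rfl⟩
    · obtain ⟨i, j, hj, -, hsplit⟩ := exists_splitPair_layout_univ h0 h1 hcard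
      refine Or.inr (Or.inl ⟨j, by omega, ?_⟩)
      ext t; simp [rightPart, hsplit]
    · obtain ⟨j, hij, hsplit⟩ := exists_splitPair_layout_Ici h0 h1 hcard hi
      refine Or.inr (Or.inl ⟨j, by omega, ?_⟩)
      ext t; simp only [rightPart, hsplit, mem_filter, mem_Ici, Fin.le_def]; omega
    · obtain ⟨i, -, hsplit⟩ := exists_splitPair_layout_Iic h0 h1 hcard hj
      have hsub : rightPart (layout k δ) (Iic j) hcard ⊆ {j} := fun t ht => by
        simp only [rightPart, hsplit, mem_filter, mem_Iic] at ht
        exact mem_singleton.2 (le_antisymm ht.1 ht.2)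
      have := card_le_card hsub
      rw [card_singleton] at this
      omega

theorem criticalPoint_layout_eq_separator (h0 : 0 < δ) (h1 : δ < 1) (h : 2 ≤ S.card)
    (hS : PtcpNode (layout k δ) S) (hs : i ∈ leftPart (layout k δ) S h)
    (ht : j ∈ rightPart (layout k δ) S h) :
    criticalPoint (layout k δ) S h = separator (layout k δ) (layoutCritical k δ) i j := by
  have hmono := layout_strictMono (k := k) h0 h1
  rcases hS.layout_cases h0 h1 h with rfl | ⟨a, ha, rfl⟩ | ⟨b, hb, rfl⟩
  · obtain ⟨a, b, hb, hab, hsplit⟩ := exists_splitPair_layout_univ h0 h1 h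
    simp only [leftPart, rightPart, hsplit, mem_filter, Fin.le_def] at hs ht
    rw [criticalPoint_layout_univ h0 h1, separator_of_neg_of_pos]
    · linarith [layout_le_neg_one (j := i) h0 h1 (by omega)]
    · linarith [one_le_layout (j := j) h0 h1 (by omega)]
  · obtain ⟨b, hab, hsplit⟩ := exists_splitPair_layout_Ici h0 h1 h ha
    simp only [leftPart, rightPart, hsplit, mem_filter, mem_Ici] at hs ht
    obtain rfl := le_antisymm hs.2 hs.1
    rw [criticalPoint_layout_Ici h0 h1 h ha, separator_of_pos_of_lt]
    · linarith [one_le_layout h0 h1 ha]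
    · exact hmono (Fin.lt_def.2 (by have := Fin.le_def.1 ht.2; omega))
  · obtain ⟨a, hab, hsplit⟩ := exists_splitPair_layout_Iic h0 h1 h hb
    simp only [leftPart, rightPart, hsplit, mem_filter, mem_Iic] at hs ht
    obtain rfl := le_antisymm ht.1 ht.2
    rw [criticalPoint_layout_Iic h0 h1 h hb, separator_of_neg_of_lt]
    · linarith [layout_le_neg_one h0 h1 hb]
    · exact hmono (Fin.lt_def.2 (by have := Fin.le_def.1 hs.2; omega))

theorem ptcp_isCompetitive (h0 : 0 < δ) (h1 : δ < 1) (hK : 2 * (1 - δ)⁻¹ ≤ K - 1)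
    (c : Fin (2 * k) → ℕ) : IsCompetitive (layout k δ) (ptcp (layout k δ) c) K := by
  have hA := ptcp_followsPreference (layout_strictMono h0 h1)
    (fun h hS => criticalPoint_layout_eq_separator (k := k) h0 h1 h hS) c
  exact hA.isCompetitive (twoSided_layout h0 h1 hK)

end Layout

section Permutation

variable {m : ℕ} {p : Fin m → ℝ} {c : Fin m → ℕ} {M N : Matching m} {s : Fin m} {η : ℝ}
  {q : ℕ → ℝ} {e : ℕ → Fin m} {j : ℕ}

/-- Every request of the matching stands at the place of its server. -/
def AtServers (p : Fin m → ℝ) (M : Matching m) : Prop := ∀ x ∈ M, x.1 = p x.2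

theorem cost_eq_zero_iff : cost p M = 0 ↔ AtServers p M := by
  induction M with
  | nil => simp [cost, AtServers]
  | cons x M ih =>
    rw [cost_cons, add_eq_zero_iff_of_nonneg (abs_nonneg _) (cost_nonneg p M), ih, AtServers,
      AtServers, List.forall_mem_cons, abs_eq_zero, sub_eq_zero]

theorem load_replicate (n : ℕ) (x : ℝ × Fin m) :
    load (List.replicate n x) = Pi.single x.2 n := by
  ext t
  simp [load, List.countP_replicate, Pi.single_apply, eq_comm]

theorem exists_atServers (p : Fin m → ℝ) (f : Fin m → ℕ) :
    ∃ N : Matching m, load N = f ∧ AtServers p N := by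
  induction f using Pi.single_induction with
  | zero => exact ⟨[], rfl, by simp [AtServers]⟩
  | add f g hf hg =>
    obtain ⟨N, rfl, hN⟩ := hf
    obtain ⟨N', rfl, hN'⟩ := hg
    refine ⟨N ++ N', funext (load_append N N'), fun x hx => ?_⟩
    exact (List.mem_append.1 hx).elim (hN x) (hN' x)
  | single s n =>
    refine ⟨List.replicate n (p s, s), load_replicate n _, fun x hx => ?_⟩
    rw [List.eq_of_mem_replicate hx]

theorem AtServers.load_eq_count (hM : AtServers p M) (hp : Function.Injective p) (s : Fin m) :
    load M s = (M.map Prod.fst).count (p s) := by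
  rw [load, List.count_eq_countP, List.countP_map]
  exact List.countP_congr fun x hx => by simp [hM x hx, hp.eq_iff]

theorem sum_map_snd (g : Fin m → ℝ) (M : Matching m) :
    (M.map fun x => g x.2).sum = ∑ t, load M t * g t := by
  induction M with
  | nil => simp [load_nil]
  | cons x M ih => simp [load_cons, ih, add_mul, sum_add_distrib, add_comm]

theorem sum_sub_sum_load_mul_le_cost {f : ℝ → ℝ} (hf : LipschitzWith 1 f) (p : Fin m → ℝ)
    (M : Matching m) : ((M.map Prod.fst).map f).sum - ∑ t, load M t * f (p t) ≤ cost p M := by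
  rw [← sum_map_snd fun t => f (p t)]
  induction M with
  | nil => simp [cost]
  | cons x M ih =>
    have hx := (Real.le_norm_self _).trans (hf.norm_sub_le x.1 (p x.2))
    rw [NNReal.coe_one, one_mul, Real.norm_eq_abs] at hx
    simp only [List.map_cons, List.sum_cons, cost_cons]
    linarith

theorem AtServers.sum_map_fst (hN : AtServers p N) (f : ℝ → ℝ) :
    ((N.map Prod.fst).map f).sum = ∑ t, load N t * f (p t) := by
  rw [← sum_map_snd fun t => f (p t), List.map_map]
  exact congrArg List.sum (List.map_congr_left fun x hx => congrArg f (hN x hx))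

/-- By Kantorovich duality, with the `1`-Lipschitz function `|· - p s|`. -/
theorem AtServers.abs_sub_le_cost (hN : AtServers p N)
    (hreq : (M.map Prod.fst).Perm (η :: N.map Prod.fst)) (hload : load M = load N + Pi.single s 1) :
    |η - p s| ≤ cost p M := by
  have hf : LipschitzWith 1 fun x => |x - p s| := LipschitzWith.of_dist_le_mul fun x y => by
    simpa [Real.dist_eq] using abs_abs_sub_abs_le_abs_sub (x - p s) (y - p s)
  have h := sum_sub_sum_load_mul_le_cost hf p M
  rw [(hreq.map _).sum_eq, List.map_cons, List.sum_cons, hN.sum_map_fst, hload] at h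
  simpa [add_mul, sum_add_distrib, Pi.single_apply] using h

/-- The requests `q 0, …, q (j - 1)`, served by `e 0, …, e (j - 1)` in this order. -/
def serve (q : ℕ → ℝ) (e : ℕ → Fin m) (j : ℕ) : Matching m :=
  (List.range j).map fun i => (q i, e i)

theorem serve_succ (q : ℕ → ℝ) (e : ℕ → Fin m) (j : ℕ) :
    serve q e (j + 1) = serve q e j ++ [(q j, e j)] := by
  simp only [serve, List.range_succ, List.map_append, List.map_singleton]

theorem load_serve (q : ℕ → ℝ) (e : ℕ → Fin m) (j : ℕ) :
    load (serve q e j) = ∑ i ∈ range j, Pi.single (e i) 1 := by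
  induction j with
  | zero => rfl
  | succ j ih => rw [serve_succ, load_snoc, ih, sum_range_succ]

/-- The requests `η, p (e 0), p (e 1), …`. -/
def chase (p : Fin m → ℝ) (η : ℝ) (e : ℕ → Fin m) : ℕ → ℝ
  | 0 => η
  | j + 1 => p (e j)

/-- The requests of `N`, followed by the first `j` requests of `chase p η e`. -/
def chaseSequence (p : Fin m → ℝ) (η : ℝ) (e : ℕ → Fin m) (N : Matching m) (j : ℕ) : List ℝ :=
  (N ++ serve (chase p η e) e j).map Prod.fst

theorem chaseSequence_succ (p : Fin m → ℝ) (η : ℝ) (e : ℕ → Fin m) (N : Matching m) (j : ℕ) :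
    chaseSequence p η e N (j + 1) = chaseSequence p η e N j ++ [chase p η e j] := by
  simp only [chaseSequence, serve_succ, List.map_append, List.map_singleton, List.append_assoc]

theorem chaseSequence_succ_perm (p : Fin m → ℝ) (η : ℝ) (e : ℕ → Fin m) (N : Matching m) (j : ℕ) :
    (chaseSequence p η e N (j + 1)).Perm (η :: (N ++ serve (p ∘ e) e j).map Prod.fst) := by
  simp [chaseSequence, serve, List.range_succ_eq_map, chase, Function.comp_def]

/-- `e 0, e 1, …` lists the servers by their distances from `η`, alternating between the two sides
of `η`. -/
structure IsChaseOrder (p : Fin m → ℝ) (η : ℝ) (e : ℕ → Fin m) : Prop where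
  surj : ∀ s, ∃ i < m, e i = s
  dist_lt : ∀ {i j}, i < j → j < m → |η - p (e i)| < |η - p (e j)|
  dist_add_le : ∀ {j}, j + 2 < m →
    |η - p (e j)| + |p (e j) - p (e (j + 2))| ≤ |η - p (e (j + 2))|

theorem IsChaseOrder.load_serve_le_one (he : IsChaseOrder p η e) (hj : j ≤ m) :
    load (serve q e j) ≤ 1 := fun t => by
  have hunique : ((range j).filter fun i => t = e i).card ≤ 1 := by
    refine card_le_one.2 fun a ha b hb => ?_
    rw [mem_filter, mem_range] at ha hb
    have hab : |η - p (e a)| = |η - p (e b)| := by rw [← ha.2, ← hb.2]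
    rcases lt_trichotomy a b with h | h | h
    · exact absurd hab (he.dist_lt h (hb.1.trans_le hj)).ne
    · exact h
    · exact absurd hab (he.dist_lt h (ha.1.trans_le hj)).ne'
  simpa [load_serve, Finset.sum_apply, Pi.single_apply] using hunique

theorem load_serve_pos {i : ℕ} (h : i < j) : 0 < load (serve q e j) (e i) := by
  rw [load_serve, Finset.sum_apply]
  exact sum_pos_iff.2 ⟨i, mem_range.2 h, by simp⟩

/-- The matching pairs off the last two servers: the last request stands at the last server but
one, and the request before moves on to the last server, on its own side of `η`. -/
theorem IsChaseOrder.exists_serve (he : IsChaseOrder p η e) : ∀ j ≤ m, ∃ M : Matching m,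
    M.map Prod.fst = (serve (chase p η e) e j).map Prod.fst ∧
      load M = load (serve (chase p η e) e j) ∧ cost p M ≤ |η - chase p η e j|
  | 0, _ => ⟨[], rfl, rfl, abs_nonneg _⟩
  | 1, _ => ⟨[(η, e 0)], rfl, rfl, by simp [cost, chase]⟩
  | j + 2, hj => by
    obtain ⟨M, hreq, hload, hcost⟩ := he.exists_serve j (by omega)
    have hstep : |η - chase p η e j| + |chase p η e j - p (e (j + 1))| ≤ |η - p (e (j + 1))| := by
      cases j with
      | zero => simp [chase]
      | succ j => exact he.dist_add_le hj
    refine ⟨M ++ [(chase p η e j, e (j + 1))] ++ [(chase p η e (j + 1), e j)], ?_, ?_, ?_⟩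
    · simp [serve_succ, hreq]
    · rw [serve_succ, serve_succ]
      simp only [load_snoc, hload, add_right_comm]
    · rw [cost_snoc, cost_snoc, chase, chase, sub_self, abs_zero, add_zero]
      exact (add_le_add_left hcost _).trans hstep

theorem IsChaseOrder.exists_isMatching (he : IsChaseOrder p η e) (hN : AtServers p N)
    (hc : load N + 1 = c) (hj : j ≤ m) : ∃ M,
      IsMatching c (chaseSequence p η e N j) M ∧ cost p M ≤ |η - chase p η e j| := by
  obtain ⟨M, hreq, hload, hcost⟩ := he.exists_serve j hj
  refine ⟨N ++ M, ⟨?_, fun t => ?_⟩, ?_⟩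
  · rw [chaseSequence, List.map_append, hreq, List.map_append]
  · rw [load_append, hload, ← hc]
    exact Nat.add_le_add_left (he.load_serve_le_one hj t) _
  · rwa [cost_append, cost_eq_zero_iff.2 hN, zero_add]

theorem IsChaseOrder.admissible (he : IsChaseOrder p η e) (hN : AtServers p N)
    (hc : load N + 1 = c) (hj : j ≤ m) : Admissible c (chaseSequence p η e N j) := by
  obtain ⟨M, hM, -⟩ := he.exists_isMatching hN hc hj
  rw [Admissible, ← hM.1, List.length_map, ← sum_load]
  exact sum_le_sum fun s _ => hM.2 s

theorem IsChaseOrder.cost_le (he : IsChaseOrder p η e) (hN : AtServers p N)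
    (hc : load N + 1 = c) (hj : j ≤ m)
    (hM : IsOptimalMatching p c (chaseSequence p η e N j) M) : cost p M ≤ |η - chase p η e j| := by
  obtain ⟨M', hM', hcost⟩ := he.exists_isMatching hN hc hj
  exact (hM.2 M' hM').trans hcost

theorem IsChaseOrder.eq_of_load_eq (he : IsChaseOrder p η e) (hN : AtServers p N)
    (hc : load N + 1 = c) (hj : j < m)
    (hM : IsOptimalMatching p c (chaseSequence p η e N (j + 1)) M)
    (hload : load M = load (N ++ serve q e j) + Pi.single s 1) : s = e j := by
  have hserve : AtServers p (N ++ serve (p ∘ e) e j) := by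
    simpa [AtServers, serve, or_imp, forall_and] using hN
  have hload' : load M = load (N ++ serve (p ∘ e) e j) + Pi.single s 1 := by
    rw [hload]
    ext t
    simp only [Pi.add_apply, load_append, load_serve]
  have hs : |η - p s| ≤ |η - p (e j)| :=
    (hserve.abs_sub_le_cost (hM.1.1 ▸ chaseSequence_succ_perm p η e N j) hload').trans
      (he.cost_le hN hc hj hM)
  obtain ⟨i, hi, rfl⟩ := he.surj s
  rcases lt_trichotomy i j with hij | rfl | hij
  · have hcap := hM.1.2 (e i)
    have hpos := load_serve_pos (q := q) (e := e) hij
    rw [hload, Pi.add_apply, load_append, Pi.single_eq_same, ← hc, Pi.add_apply,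
      Pi.one_apply] at hcap
    omega
  · rfl
  · exact absurd hs (he.dist_lt hij hi).not_ge

/-- `N` leaves a single place at every server, so that the optimal matching has to use a new
server whenever the chase is extended, and the closest one to `η` is the only cheap choice. -/
theorem IsChaseOrder.run_eq (he : IsChaseOrder p η e) (hp : Function.Injective p)
    (hN : AtServers p N) (hc : load N + 1 = c) {P : OnlineAlgorithm c}
    (hP : IsPermutationAlgorithm p P) (hj : j ≤ m) :
    P.run (chaseSequence p η e N j) = P.run (N.map Prod.fst) ++ serve (chase p η e) e j := by
  obtain ⟨Opt, hOpt, hstep⟩ := hP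
  have hOpt' : ∀ {j}, j ≤ m → IsOptimalMatching p c (chaseSequence p η e N j)
    (Opt (chaseSequence p η e N j)) := fun hj => hOpt _ (he.admissible hN hc hj)
  suffices h : load (Opt (chaseSequence p η e N j)) = load (N ++ serve (chase p η e) e j) ∧
      P.run (chaseSequence p η e N j) = P.run (N.map Prod.fst) ++ serve (chase p η e) e j from h.2
  induction j with
  | zero =>
    have hcost := he.cost_le hN hc hj (hOpt' hj)
    rw [chase, sub_self, abs_zero] at hcost
    have hzero := cost_eq_zero_iff.1 (hcost.antisymm (cost_nonneg p _))
    refine ⟨funext fun t => ?_, by simp [chaseSequence, serve]⟩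
    rw [hzero.load_eq_count hp, (hOpt' hj).1.1, load_append, hN.load_eq_count hp]
    simp [chaseSequence, serve, load_nil]
  | succ j ih =>
    obtain ⟨ih_load, ih_run⟩ := ih (by omega)
    have hM := hOpt' hj
    obtain ⟨s, hs, hrun⟩ := hstep (chaseSequence p η e N j) (chase p η e j)
      (chaseSequence_succ p η e N j ▸ he.admissible hN hc hj)
    rw [← chaseSequence_succ] at hs hrun
    have hload : load (Opt (chaseSequence p η e N (j + 1))) =
        load (N ++ serve (chase p η e) e j) + Pi.single s 1 := by
      ext t
      rw [hs, ih_load, Pi.add_apply, Pi.single_apply]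
    obtain rfl := he.eq_of_load_eq hN hc hj hM hload
    rw [serve_succ, hload, hrun, ih_run, List.append_assoc, ← List.append_assoc N, load_snoc]
    exact ⟨rfl, rfl⟩

theorem IsChaseOrder.exists_cost_le_run (he : IsChaseOrder p η e) (hp : Function.Injective p)
    (hc : ∀ s, 1 ≤ c s) {P : OnlineAlgorithm c} (hP : IsPermutationAlgorithm p P) (hj : j < m) :
    ∃ σ, Admissible c σ ∧ optCost p c σ ≤ |η - p (e j)| ∧
      cost p (serve (chase p η e) e (j + 1)) ≤ cost p (P.run σ) := by
  obtain ⟨N, hload, hN⟩ := exists_atServers p (c - 1)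
  replace hload : load N + 1 = c := by rw [hload, tsub_add_cancel_of_le hc]
  have hadm := he.admissible hN hload hj
  obtain ⟨M, hM⟩ := exists_isOptimalMatching_of_admissible p hadm
  refine ⟨_, hadm, hM.optCost_eq.trans_le (he.cost_le hN hload hj hM), ?_⟩
  rw [he.run_eq hp hN hload hP hj, cost_append]
  exact le_add_of_nonneg_left (cost_nonneg p _)

end Permutation

section Layout

variable {k i j : ℕ} {δ ε η : ℝ}

/-- The servers of the layout from the inside to the outside, alternating between the sides. -/
def zigzag (k : ℕ) (hk : 1 ≤ k) (i : ℕ) : Fin (2 * k) :=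
  let s : Fin (2 * k) := ⟨(k + i / 2) % (2 * k), Nat.mod_lt _ (by omega)⟩
  if Even i then s else s.rev

theorem layout_zigzag (hk : 1 ≤ k) (δ : ℝ) (hi : i < 2 * k) :
    layout k δ (zigzag k hk i) = (-1) ^ i * radius δ (i / 2 + 1) := by
  have hmod : (k + i / 2) % (2 * k) = k + i / 2 := Nat.mod_eq_of_lt (by omega)
  have hright : layout k δ ⟨(k + i / 2) % (2 * k), Nat.mod_lt _ (by omega)⟩ =
      radius δ (i / 2 + 1) := by
    rw [layout_of_le (by simp only [hmod]; omega)]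
    congr 1
    simp only [hmod]
    omega
  rcases i.even_or_odd with hpar | hpar
  · rw [zigzag, if_pos hpar, hright, hpar.neg_one_pow, one_mul]
  · rw [zigzag, if_neg (Nat.not_even_iff_odd.2 hpar), layout_rev, hright, hpar.neg_one_pow,
      neg_one_mul]

theorem exists_zigzag_eq (hk : 1 ≤ k) (s : Fin (2 * k)) : ∃ i < 2 * k, zigzag k hk i = s := by
  rcases lt_or_ge (s : ℕ) k with hs | hs
  · refine ⟨2 * (k - 1 - s) + 1, by omega, Fin.ext ?_⟩
    rw [zigzag, if_neg (by simp), Fin.val_rev]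
    simp only [Nat.mod_eq_of_lt (show k + (2 * (k - 1 - s) + 1) / 2 < 2 * k by omega)]
    omega
  · refine ⟨2 * (s - k), by omega, Fin.ext ?_⟩
    rw [zigzag, if_pos (even_two_mul _)]
    simp only [Nat.mod_eq_of_lt (show k + 2 * (s - k) / 2 < 2 * k by omega)]
    omega

theorem abs_sub_layout_zigzag (hk : 1 ≤ k) (h0 : 0 < δ) (h1 : δ < 1) (hη : |η| ≤ 1)
    (hi : i < 2 * k) :
    |η - layout k δ (zigzag k hk i)| = radius δ (i / 2 + 1) - (-1) ^ i * η := by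
  have hR := one_le_radius h0 h1 (Nat.le_add_left 1 (i / 2))
  rw [layout_zigzag hk δ hi]
  rcases neg_one_pow_eq_or ℝ i with hs | hs <;> rw [hs]
  · rw [abs_of_nonpos (by linarith [le_of_abs_le hη])]; ring
  · rw [abs_of_nonneg (by linarith [neg_le_of_abs_le hη])]; ring

theorem abs_le_one_of_two_mul_lt_pow (h0 : 0 < δ) (h1 : δ < 1) (hη : 0 < η)
    (hηδ : 2 * η < δ ^ k) : |η| ≤ 1 := by
  rw [abs_of_pos hη]
  linarith [pow_le_one₀ (n := k) h0.le h1.le]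

theorem abs_sub_layout_zigzag_lt (hk : 1 ≤ k) (h0 : 0 < δ) (h1 : δ < 1) (hη : 0 < η)
    (hηδ : 2 * η < δ ^ k) (hij : i < j) (hj : j < 2 * k) :
    |η - layout k δ (zigzag k hk i)| < |η - layout k δ (zigzag k hk j)| := by
  have hη1 := abs_le_one_of_two_mul_lt_pow h0 h1 hη hηδ
  rw [abs_sub_layout_zigzag hk h0 h1 hη1 (hij.trans hj), abs_sub_layout_zigzag hk h0 h1 hη1 hj]
  rcases (Nat.div_le_div_right hij.le : i / 2 ≤ j / 2).eq_or_lt with hdiv | hdiv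
  · have hi : Even i := Nat.even_iff.2 (by omega)
    have hj : Odd j := Nat.odd_iff.2 (by omega)
    rw [hdiv, hi.neg_one_pow, hj.neg_one_pow]
    linarith
  · have hgap : radius δ (i / 2 + 1) + δ ^ k ≤ radius δ (j / 2 + 1) :=
      calc radius δ (i / 2 + 1) + δ ^ k ≤ radius δ (i / 2 + 1) + δ ^ (i / 2 + 1) := by
            grw [pow_le_pow_of_le_one h0.le h1.le (by omega : i / 2 + 1 ≤ k)]
        _ = radius δ (i / 2 + 1 + 1) := (radius_succ h1 _).symm
        _ ≤ radius δ (j / 2 + 1) := (radius_strictMono h0 h1).monotone (by omega)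
    have hsign : ∀ n : ℕ, |(-1) ^ n * η| ≤ η := fun n => by simp [abs_mul, abs_of_pos hη]
    linarith [neg_le_of_abs_le (hsign i), le_of_abs_le (hsign j)]

theorem isChaseOrder_zigzag (hk : 1 ≤ k) (h0 : 0 < δ) (h1 : δ < 1) (hη : 0 < η)
    (hηδ : 2 * η < δ ^ k) : IsChaseOrder (layout k δ) η (zigzag k hk) where
  surj := exists_zigzag_eq hk
  dist_lt hij hj := abs_sub_layout_zigzag_lt hk h0 h1 hη hηδ hij hj
  dist_add_le {j} hj := by
    have hη1 := abs_le_one_of_two_mul_lt_pow h0 h1 hη hηδ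
    have hmono := radius_strictMono h0 h1 (Nat.lt_succ_self (j / 2 + 1))
    rw [abs_sub_layout_zigzag hk h0 h1 hη1 hj, abs_sub_layout_zigzag hk h0 h1 hη1 (by omega),
      layout_zigzag hk δ hj, layout_zigzag hk δ (by omega), Nat.add_div_right j two_pos,
      pow_add, neg_one_sq, mul_one, ← mul_sub, abs_mul, abs_neg_one_pow, one_mul,
      abs_of_neg (sub_neg.2 hmono)]
    linarith

theorem two_le_abs_layout_zigzag_sub (hk : 1 ≤ k) (h0 : 0 < δ) (h1 : δ < 1) (hj : j + 1 < 2 * k) :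
    2 ≤ |layout k δ (zigzag k hk j) - layout k δ (zigzag k hk (j + 1))| := by
  have hR := one_le_radius h0 h1 (Nat.le_add_left 1 (j / 2))
  have hR' := one_le_radius h0 h1 (Nat.le_add_left 1 ((j + 1) / 2))
  rw [layout_zigzag hk δ (by omega), layout_zigzag hk δ hj, pow_succ, mul_neg_one, neg_mul,
    sub_neg_eq_add, ← mul_add, abs_mul, abs_neg_one_pow, one_mul, abs_of_pos (by linarith)]
  linarith

theorem le_cost_serve_zigzag (hk : 1 ≤ k) (h0 : 0 < δ) (h1 : δ < 1) (hj : j < 2 * k) :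
    1 - η + 2 * j ≤ cost (layout k δ)
      (serve (chase (layout k δ) η (zigzag k hk)) (zigzag k hk) (j + 1)) := by
  induction j with
  | zero =>
    have hfirst : layout k δ (zigzag k hk 0) = 1 := by simp [layout_zigzag hk δ hj, radius_one h1]
    rw [serve_succ, cost_snoc, chase, hfirst, abs_sub_comm]
    simpa [serve, cost] using le_abs_self (1 - η)
  | succ j ih =>
    have hstep := two_le_abs_layout_zigzag_sub hk h0 h1 hj
    rw [serve_succ, cost_snoc, chase]
    push_cast
    linarith [ih (by omega)]

theorem radius_sub_one_le (h0 : 0 < δ) (h1 : δ < 1) (k : ℕ) : radius δ k - 1 ≤ δ * radius δ k := by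
  have hmul : radius δ k * (1 - δ) = 1 - δ ^ k := div_mul_cancel₀ _ (sub_pos.2 h1).ne'
  linarith [pow_pos h0 k]

theorem sub_le_of_sub_le_mul_add {a d R ρ : ℝ} (hR : 1 ≤ R) (hRδ : R - 1 ≤ δ * R) (ha : 0 ≤ a)
    (hη : 0 ≤ η) (hd : (a + 1) * η = d) (hε : d + δ * a ≤ ε) (h : a - η ≤ ρ * (R + η)) :
    a - ε ≤ ρ := by
  have hd0 : 0 ≤ d := hd ▸ by positivity
  have hδ0 : 0 ≤ δ := nonneg_of_mul_nonneg_left (by linarith) (by linarith : 0 < R)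
  have hεη : 0 ≤ ε * η := mul_nonneg (hε.trans' (by positivity)) hη
  have hscale : (d + δ * a) * R ≤ ε * R := by gcongr
  have hmul : (a - ε) * (R + η) ≤ ρ * (R + η) := h.trans' <| by
    nlinarith [mul_le_mul_of_nonneg_left hRδ ha, le_mul_of_one_le_right hd0 hR]
  exact le_of_mul_le_mul_right hmul (by linarith)

theorem le_competitiveRatio_of_isPermutationAlgorithm (hk : 1 ≤ k) (h0 : 0 < δ) (h1 : δ < 1)
    (hδ : δ ^ k + δ * (4 * (k : ℝ) - 1) < ε) {c : Fin (2 * k) → ℕ} (hc : ∀ s, 1 ≤ c s)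
    {P : OnlineAlgorithm c} (hP : IsPermutationAlgorithm (layout k δ) P) :
    ((4 * (k : ℝ) - 1 - ε : ℝ) : EReal) ≤ competitiveRatio (layout k δ) P := by
  refine le_sInf ?_
  rintro _ ⟨ρ, ⟨hρ1, hρ⟩, rfl⟩
  rw [EReal.coe_le_coe_iff]
  have hk' : (1 : ℝ) ≤ k := by exact_mod_cast hk
  obtain ⟨η, hη⟩ : ∃ η : ℝ, η * (4 * k) = δ ^ k := ⟨_, div_mul_cancel₀ _ (by positivity)⟩
  have hη0 : 0 < η := pos_of_mul_pos_left (hη ▸ pow_pos h0 k) (by positivity)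
  have hηδ : 2 * η < δ ^ k := by nlinarith
  have hη1 := abs_le_one_of_two_mul_lt_pow h0 h1 hη0 hηδ
  have hlast : 2 * k - 1 < 2 * k := by omega
  obtain ⟨σ, hσ, hopt, hcost⟩ := (isChaseOrder_zigzag hk h0 h1 hη0 hηδ).exists_cost_le_run
    (layout_strictMono h0 h1).injective hc hP hlast
  have hodd : Odd (2 * k - 1) := Nat.odd_iff.2 (by omega)
  rw [abs_sub_layout_zigzag hk h0 h1 hη1 hlast, show (2 * k - 1) / 2 + 1 = k by omega,
    hodd.neg_one_pow, neg_one_mul, sub_neg_eq_add] at hopt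
  have hlow := (le_cost_serve_zigzag (η := η) hk h0 h1 hlast).trans hcost
  rw [Nat.cast_sub (by omega)] at hlow
  push_cast at hlow
  refine sub_le_of_sub_le_mul_add (one_le_radius h0 h1 hk) (radius_sub_one_le h0 h1 k)
    (by linarith) hη0.le (by linarith) hδ.le ?_
  calc 4 * (k : ℝ) - 1 - η = 1 - η + 2 * (2 * k - 1) := by ring
    _ ≤ cost (layout k δ) (P.run σ) := hlow
    _ ≤ ρ * optCost (layout k δ) c σ := hρ σ hσ
    _ ≤ ρ * (radius δ k + η) := by gcongr

theorem exists_layout_parameter (hk : 1 ≤ k) (hε : 0 < ε) :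
    ∃ δ : ℝ, 0 < δ ∧ δ < 1 ∧ δ ^ k + δ * (4 * (k : ℝ) - 1) < ε ∧ (1 - δ)⁻¹ < 1 + ε / 2 := by
  have hk' : (1 : ℝ) ≤ k := by exact_mod_cast hk
  obtain ⟨δ, h0, h1⟩ := exists_between (show (0 : ℝ) < min (1 / 2) (ε / (4 * k)) by positivity)
  obtain ⟨hhalf, hlt⟩ := lt_min_iff.1 h1
  rw [lt_div_iff₀ (by positivity)] at hlt
  have hpow : δ ^ k ≤ δ := pow_le_of_le_one h0.le (by linarith) (by omega)
  refine ⟨δ, h0, by linarith, by linarith, ?_⟩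
  rw [inv_lt_iff_one_lt_mul₀ (by linarith)]
  nlinarith

end Layout

end OFAL

theorem mainTheorem4 (k : ℕ) (hk : 1 ≤ k) (ε : ℝ) (hε : 0 < ε) :
    (∃ δ : ℝ, 0 < δ ∧ δ < 1 ∧ δ ^ k + δ * (4 * (k : ℝ) - 1) < ε ∧ (1 - δ)⁻¹ < 1 + ε / 2) ∧
    ∀ δ : ℝ, 0 < δ → δ < 1 → δ ^ k + δ * (4 * (k : ℝ) - 1) < ε → (1 - δ)⁻¹ < 1 + ε / 2 →
      ∀ c : Fin (2 * k) → ℕ, (∀ s, 1 ≤ c s) →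
        OFAL.IsCompetitive (OFAL.layout k δ) (OFAL.ptcp (OFAL.layout k δ) c) (3 + ε) ∧
        ∀ P : OFAL.OnlineAlgorithm c, OFAL.IsPermutationAlgorithm (OFAL.layout k δ) P →
          ((4 * (k : ℝ) - 1 - ε : ℝ) : EReal) ≤
            OFAL.competitiveRatio (OFAL.layout k δ) P :=
  ⟨OFAL.exists_layout_parameter hk hε, fun _ h0 h1 h2 h3 c hc =>
    ⟨OFAL.ptcp_isCompetitive h0 h1 (by linarith) c, fun _ hP =>
      OFAL.le_competitiveRatio_of_isPermutationAlgorithm hk h0 h1 h2 hc hP⟩⟩
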